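/- Let $0<G_0\le G_1$ and $\epsilon_0>0$ be constants, and $I=(0,1)$. A function $G:I\to[G_0,G_1]$ is called a profile if it is piecewise $C^1$ (that is, $C^1$ off a finite set, with $G$ and $G'$ having finite one-sided limits at every point of $[0,1]$), its value at a jump being the smaller of its two one-sided limits there. Put $$\Omega_G=\{(x_1,x_2)\in\mathbb R^2:\ x_1\in I,\ 0<x_2<G(x_1)\}.$$ For $w\in H^1(U)$, $A\subset U$ measurable and $\epsilon>0$ write $$\|w\|^2_{H^1_\epsilon(A)}=\|w\|^2_{L^2(A)}+\|\partial_{x_1}w\|^2_{L^2(A)}+\frac1{\epsilon^2}\|\partial_{x_2}w\|^2_{L^2(A)}.$$ For $f\in L^2(\mathbb R^2)$, the solution in $\Omega_G$ is the function $u\in H^1(\Omega_G)$ with $$\int_{\Omega_G}\Big\{\partial_{x_1}u\,\partial_{x_1}\varphi+\frac1{\epsilon^2}\partial_{x_2}u\,\partial_{x_2}\varphi+u\varphi\Big\}\,dx_1dx_2=\int_{\Omega_G}f\varphi\,dx_1dx_2\qquad\text{for all }\varphi\in H^1(\Omega_G),$$ i.e. the variational solution of $-\partial_{x_1}^2u-\epsilon^{-2}\partial_{x_2}^2u+u=f$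 in $\Omega_G$ with $\partial_{x_1}u\,N_1+\epsilon^{-2}\partial_{x_2}u\,N_2=0$ on $\partial\Omega_G$, where $N=(N_1,N_2)$ is the outward unit normal. **Theorem.** There is a function $\rho:[0,\infty)\to[0,\infty)$, depending only on $G_0$, $G_1$ and the upper bound $\epsilon_0$ for $\epsilon$, with $\rho(\delta)\to0$ as $\delta\to0$, and in fact $\rho(\delta)\le C\delta^{1/4}$ for all $\delta\ge0$ with a constant $C$, such that the following holds. For all $\delta\ge0$, all $\epsilon\in(0,\epsilon_0)$, all profiles $G_\epsilon,\hat G_\epsilon:I\to[G_0,G_1]$ with $\|G_\epsilon-\hat G_\epsilon\|_{L^\infty(0,1)}\le\delta$, and all $f^\epsilon\in L^2(\mathbb R^2)$ with $\|f^\epsilon\|_{L^2(\mathbb R^2)}\le1$, the solutions $u^\epsilon$ in $\Omega^\epsilon=\Omega_{G_\epsilon}$ and $\hat u^\epsilon$ in $\hat\Omega^\epsilon=\Omega_{\hat G_\epsilon}$ with right-hand side $f^\epsilon$ satisfy $$\|u^\epsilon-\hat u^\epsilon\|^2_{H^1_\epsilon(\Omega^\epsilon\cap\hat\Omega^\epsilon)}+\|u^\epsilon\|^2_{H^1_\epsilon(\Omega^\epsilon\setminus\hat\Omega^\epsilon)}+\|\hat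 u^\epsilon\|^2_{H^1_\epsilon(\hat\Omega^\epsilon\setminus\Omega^\epsilon)}\le\rho(\delta).$$ -/

import Mathlib

open Set Filter Topology MeasureTheory
open scoped NNReal ENNReal ContDiff

noncomputable section

namespace ThinDomain

/-- `G` is piecewise `C¹` on `(0,1)`: it is `C¹` off a finite set, and both `G` and its derivative
have finite one-sided limits at every point of `[0,1]` (from inside the interval). -/
structure IsPiecewiseC1 (G : ℝ → ℝ) : Prop where
  contDiffOn : ∃ S : Finset ℝ, ContDiffOn ℝ 1 G (Ioo 0 1 \ (S : Set ℝ))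
  right_limits : ∀ x ∈ Ico (0 : ℝ) 1,
    (∃ l, Tendsto G (𝓝[>] x) (𝓝 l)) ∧ ∃ l, Tendsto (deriv G) (𝓝[>] x) (𝓝 l)
  left_limits : ∀ x ∈ Ioc (0 : ℝ) 1,
    (∃ l, Tendsto G (𝓝[<] x) (𝓝 l)) ∧ ∃ l, Tendsto (deriv G) (𝓝[<] x) (𝓝 l)

/-- The convention for the value of a profile at a jump: the smaller of the two one-sided limits.
At a point of continuity the condition holds automatically. -/
def TakesMinAtJumps (G : ℝ → ℝ) : Prop :=
  ∀ x ∈ Ioo (0 : ℝ) 1, ∀ l r : ℝ,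
    Tendsto G (𝓝[<] x) (𝓝 l) → Tendsto G (𝓝[>] x) (𝓝 r) → G x = min l r

/-- An admissible profile: piecewise `C¹`, with values between `G₀` and `G₁`. -/
structure IsProfile (G₀ G₁ : ℝ) (G : ℝ → ℝ) : Prop where
  piecewiseC1 : IsPiecewiseC1 G
  minAtJumps : TakesMinAtJumps G
  bounds : ∀ x ∈ Ioo (0 : ℝ) 1, G₀ ≤ G x ∧ G x ≤ G₁

/-- The domain `{(x₁,x₂) : 0 < x₁ < 1, 0 < x₂ < G x₁}` under the profile `G`. -/
def domain (G : ℝ → ℝ) : Set (ℝ × ℝ) :=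
  {x | x.1 ∈ Ioo (0 : ℝ) 1 ∧ 0 < x.2 ∧ x.2 < G x.1}

/-- Smooth functions with compact support in `U`. -/
structure IsTestFunction (U : Set (ℝ × ℝ)) (φ : ℝ × ℝ → ℝ) : Prop where
  smooth : ContDiff ℝ ∞ φ
  compact : HasCompactSupport φ
  support : tsupport φ ⊆ U

/-- `g` is the weak derivative of `u` on `U` in the direction `v`. -/
def IsWeakDeriv (U : Set (ℝ × ℝ)) (v : ℝ × ℝ) (u g : ℝ × ℝ → ℝ) : Prop :=
  ∀ φ : ℝ × ℝ → ℝ, IsTestFunction U φ →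
    ∫ x in U, u x * fderiv ℝ φ x v = -∫ x in U, g x * φ x

/-- An element of the Sobolev space `H¹(U)`: a function in `L²(U)` together with (representatives
of) its two weak partial derivatives, which are required to lie in `L²(U)`. -/
structure H1 (U : Set (ℝ × ℝ)) where
  val : ℝ × ℝ → ℝ
  d₁ : ℝ × ℝ → ℝ
  d₂ : ℝ × ℝ → ℝ
  memLp_val : MemLp val 2 (volume.restrict U)
  memLp_d₁ : MemLp d₁ 2 (volume.restrict U)
  memLp_d₂ : MemLp d₂ 2 (volume.restrict U)
  weak_d₁ : IsWeakDeriv U (1, 0) val d₁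
  weak_d₂ : IsWeakDeriv U (0, 1) val d₂

/-- The square of the `H¹_ε` norm, over the set `A`, of a function `w` with partial derivatives
`w₁` and `w₂`. -/
def normSq (ε : ℝ) (A : Set (ℝ × ℝ)) (w w₁ w₂ : ℝ × ℝ → ℝ) : ℝ :=
  (∫ x in A, w x ^ 2) + (∫ x in A, w₁ x ^ 2) + 1 / ε ^ 2 * ∫ x in A, w₂ x ^ 2

/-- `u ∈ H¹(U)` is the (variational) solution of
`-∂₁₁ u - ε⁻² ∂₂₂ u + u = f` in `U` with `∂₁ u N₁ + ε⁻² ∂₂ u N₂ = 0` on the boundary. -/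
def IsSolution (ε : ℝ) {U : Set (ℝ × ℝ)} (f : ℝ × ℝ → ℝ) (u : H1 U) : Prop :=
  ∀ φ : H1 U,
    ∫ x in U, (u.d₁ x * φ.d₁ x + 1 / ε ^ 2 * (u.d₂ x * φ.d₂ x) + u.val x * φ.val x)
      = ∫ x in U, f x * φ.val x

end ThinDomain

end

/-!
Both `Ω` and `Ω̂` are subgraphs, and so is `D = Ω ∩ Ω̂`, under the smaller of the two profiles. A
solution minimizes the energy `½‖v‖² - ∫ f v` of its domain (`IsSolution.energy_le`), `‖·‖` being the
`H¹_ε` norm. A competitor `φ` on `D` becomes one on `Ω` by the vertical dilation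
`ψ(x₁, x₂) = φ(x₁, x₂ / l)` with `l = 1 + δ / G₀` (`H1.dilate`). As `l` is constant, this raises the
squared norm by the factor `l` at most, whatever the slopes of the profiles; this is why the estimate
depends on the profiles only through their bounds. The terms with `f` change by `O(√δ)`, since
`‖ψ - φ‖_{L²(D)}` and the `L²` norms of `u` and `ψ` over the strip `Ω \ D`, of height at most `δ`, are
`O(√δ)`. So `u` minimizes the energy on `D` up to `O(√δ)`, with the norm of `u` over `Ω \ D` counted in
as well (`IsSolution.energy_le_of_subdomain`). The same holds for `û`. Taking for `φ` the midpoint of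
`u` and `û` on `D`, the parallelogram identity bounds the whole left-hand side by `O(√δ)`
(`discrepancy_le_energyError`). This is below `C δ^{1/4}` for `δ ≤ 1`, and for `δ ≥ 1` the bound
`‖u‖, ‖û‖ ≤ 1` is enough.

The two smallness statements follow from one-dimensional estimates on vertical lines, on almost all
of which an `H¹` function is a primitive of its weak derivative (`H1.ae_exists_eq_primitive`). To see
this, one tests the increment `u(x + h e₂) - u(x)` against `φ` supported where both points lie in the
domain. All translates of `φ` on the way are then test functions on the domain, which gives
`u(x + h e₂) - u(x) = ∫₀ʰ ∂₂u(x + s e₂) ds` for almost every `x`, and Fubini's theorem in `(h, x)` does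
the rest.
-/

namespace ThinDomain

/-! ### Vertical increments of weakly differentiable functions -/

/-- Subgraphs are convex in the vertical direction, so the intermediate translates of `φ` are
supported in the domain if the two extreme ones are. -/
theorem IsTestFunction.translate {H : ℝ → ℝ} {h s : ℝ} {φ : ℝ × ℝ → ℝ}
    (hφ : IsTestFunction {x | x ∈ domain H ∧ x + (0, h) ∈ domain H} φ) (hs : s ∈ uIcc 0 h) :
    IsTestFunction (domain H) (fun x => φ (x - (0, s))) := by
  have hts : tsupport (fun x => φ (x - (0, s)))
      = (Homeomorph.subRight ((0 : ℝ), s)) ⁻¹' tsupport φ :=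
    tsupport_comp_eq_preimage φ (Homeomorph.subRight ((0 : ℝ), s))
  refine ⟨hφ.smooth.comp (contDiff_id.sub contDiff_const),
    hφ.compact.comp_homeomorph (Homeomorph.subRight ((0 : ℝ), s)), ?_⟩
  rw [hts]
  intro x hx
  obtain ⟨⟨h1, h2, h3⟩, -, h5, h6⟩ := hφ.support hx
  simp only [Homeomorph.coe_subRight, Prod.fst_sub, Prod.snd_sub, Prod.fst_add, Prod.snd_add,
    sub_zero, add_zero] at h1 h2 h3 h5 h6
  refine ⟨h1, ?_⟩
  rcases mem_uIcc.1 hs with hs | hs <;> constructor <;> linarith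

theorem setIntegral_eq_integral_of_tsupport_subset {U : Set (ℝ × ℝ)} {k φ : ℝ × ℝ → ℝ}
    (hφ : tsupport φ ⊆ U) : ∫ x in U, k x * φ x = ∫ x, k x * φ x := by
  refine setIntegral_eq_integral_of_forall_compl_eq_zero fun x hx => ?_
  rw [image_eq_zero_of_notMem_tsupport fun h => hx (hφ h), mul_zero]

theorem tsupport_fderiv_apply_subset (φ : ℝ × ℝ → ℝ) (v : ℝ × ℝ) :
    tsupport (fun x => fderiv ℝ φ x v) ⊆ tsupport φ :=
  closure_minimal (fun x hx => support_fderiv_subset ℝ (f := φ)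
    fun h0 : fderiv ℝ φ x = 0 => hx (by simp [h0])) (isClosed_tsupport φ)

theorem IsWeakDeriv.integral_eq {U : Set (ℝ × ℝ)} {v : ℝ × ℝ} {u g φ : ℝ × ℝ → ℝ}
    (h : IsWeakDeriv U v u g) (hφ : IsTestFunction U φ) :
    ∫ x, u x * fderiv ℝ φ x v = -∫ x, g x * φ x := by
  rw [← setIntegral_eq_integral_of_tsupport_subset hφ.support,
    ← setIntegral_eq_integral_of_tsupport_subset
      ((tsupport_fderiv_apply_subset φ v).trans hφ.support)]
  exact h φ hφ

/-- The shear `(s, x) ↦ (s, x + (0, s))` preserves Lebesgue measure, also when `s` is restricted to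
a set. -/
theorem measurePreserving_vertical_shear (μ : Measure ℝ) [SFinite μ] :
    MeasurePreserving (fun p : ℝ × (ℝ × ℝ) => (p.1, p.2 + (0, p.1)))
      (μ.prod volume) (μ.prod volume) := by
  refine (MeasurePreserving.id μ).skew_product (g := fun s (x : ℝ × ℝ) => x + (0, s))
    (by fun_prop) (ae_of_all _ fun s => ?_)
  exact (measurePreserving_add_right volume ((0 : ℝ), s)).map_eq

theorem integral_mul_translate (u φ : ℝ × ℝ → ℝ) (t : ℝ × ℝ) :
    ∫ x, u x * φ (x - t) = ∫ x, u (x + t) * φ x := by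
  rw [← integral_add_right_eq_self (fun x => u x * φ (x - t)) t]
  simp

theorem isFiniteMeasure_restrict_uIoc (a b : ℝ) :
    IsFiniteMeasure (volume.restrict (uIoc a b)) := by
  rw [uIoc]; infer_instance

theorem IsTestFunction.exists_bound {U : Set (ℝ × ℝ)} {φ : ℝ × ℝ → ℝ} (hφ : IsTestFunction U φ) :
    ∃ C, ∀ x, ‖φ x‖ ≤ C := by
  exact hφ.compact.exists_bound_of_continuous hφ.smooth.continuous

theorem IsTestFunction.exists_bound_fderiv {U : Set (ℝ × ℝ)} {φ : ℝ × ℝ → ℝ}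
    (hφ : IsTestFunction U φ) (v : ℝ × ℝ) : ∃ C, ∀ x, ‖fderiv ℝ φ x v‖ ≤ C := by
  have hc : Continuous (fun x => fderiv ℝ φ x v) :=
    (hφ.smooth.continuous_fderiv (by simp)).clm_apply continuous_const
  refine HasCompactSupport.exists_bound_of_continuous ?_ hc
  exact hφ.compact.mono' (subset_closure.trans (tsupport_fderiv_apply_subset φ v))

/-- Increments in the vertical direction, tested against a function `φ` supported where both
endpoints lie in the domain: all the intermediate translates of `φ` are test functions on the
domain, so the weak derivative can be integrated along the segment. -/
theorem integral_vertical_increment {H : ℝ → ℝ} {u g φ : ℝ × ℝ → ℝ} {h : ℝ}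
    (hu : Integrable u) (hg : Integrable g) (hug : IsWeakDeriv (domain H) (0, 1) u g)
    (hφ : IsTestFunction {x | x ∈ domain H ∧ x + (0, h) ∈ domain H} φ) :
    ∫ x, (u (x + (0, h)) - u x) * φ x = ∫ x, (∫ s in (0 : ℝ)..h, g (x + (0, s))) * φ x := by
  have := isFiniteMeasure_restrict_uIoc 0 h
  obtain ⟨C, hC⟩ := hφ.exists_bound
  obtain ⟨C', hC'⟩ := hφ.exists_bound_fderiv (0, 1)
  have hφc := hφ.smooth.continuous
  have hφc' : Continuous (fun x => fderiv ℝ φ x (0, 1)) :=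
    (hφ.smooth.continuous_fderiv (by simp)).clm_apply continuous_const
  have hftc : ∀ x : ℝ × ℝ, φ (x - (0, h)) - φ x
      = -∫ s in (0 : ℝ)..h, fderiv ℝ φ (x - (0, s)) (0, 1) := by
    intro x
    have hd : ∀ s ∈ uIcc 0 h, HasDerivAt (fun s : ℝ => φ (x - (0, s)))
        (-fderiv ℝ φ (x - (0, s)) (0, 1)) s := by
      intro s _
      have h1 : HasDerivAt (fun s : ℝ => x - ((0 : ℝ), s)) (-(0, 1)) s :=
        ((hasDerivAt_const s (0 : ℝ)).prodMk (hasDerivAt_id s)).const_sub x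
      have h2 := ((hφ.smooth.differentiable (by simp)) (x - (0, s))).hasFDerivAt.comp_hasDerivAt s h1
      rw [map_neg] at h2
      exact h2
    have := intervalIntegral.integral_eq_sub_of_hasDerivAt hd
      (Continuous.intervalIntegrable (by fun_prop) _ _)
    rw [intervalIntegral.integral_neg] at this
    simp only [this, Prod.mk_zero_zero, sub_zero]
  have hI1 : Integrable (fun p : ℝ × (ℝ × ℝ) => u p.2 * fderiv ℝ φ (p.2 - (0, p.1)) (0, 1))
      ((volume.restrict (uIoc 0 h)).prod volume) := by
    refine (hu.comp_snd (volume.restrict (uIoc 0 h))).mul_bdd (c := C') ?_ (ae_of_all _ fun p => hC' _)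
    exact Continuous.aestronglyMeasurable (by fun_prop)
  have hI2 : Integrable (fun p : ℝ × (ℝ × ℝ) => g (p.2 + (0, p.1)) * φ p.2)
      ((volume.restrict (uIoc 0 h)).prod volume) := by
    have h1 := (measurePreserving_vertical_shear (volume.restrict (uIoc 0 h))).integrable_comp_of_integrable
      (hg.comp_snd (volume.restrict (uIoc 0 h)))
    refine Integrable.mul_bdd (c := C) h1 ?_ (ae_of_all _ fun p => hC _)
    exact Continuous.aestronglyMeasurable (by fun_prop)
  have hu0 : Integrable (fun x => u x * φ x) :=
    hu.mul_bdd (c := C) hφc.aestronglyMeasurable (ae_of_all _ hC)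
  have hu1 : Integrable (fun x => u x * φ (x - (0, h))) :=
    hu.mul_bdd (c := C) (Continuous.aestronglyMeasurable (by fun_prop)) (ae_of_all _ fun x => hC _)
  have hu2 : Integrable (fun x => u (x + (0, h)) * φ x) :=
    (hu.comp_add_right (0, h)).mul_bdd (c := C) hφc.aestronglyMeasurable (ae_of_all _ hC)
  calc ∫ x, (u (x + (0, h)) - u x) * φ x
      = ∫ x, u x * (φ (x - (0, h)) - φ x) := by
        simp only [sub_mul, mul_sub]
        rw [integral_sub hu2 hu0, integral_sub hu1 hu0, integral_mul_translate]
    _ = -∫ x, ∫ s in (0 : ℝ)..h, u x * fderiv ℝ φ (x - (0, s)) (0, 1) := by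
        rw [← integral_neg]
        refine integral_congr_ae (ae_of_all _ fun x => ?_)
        simp only [hftc x, mul_neg, intervalIntegral.integral_const_mul]
    _ = -∫ s in (0 : ℝ)..h, ∫ x, u x * fderiv ℝ φ (x - (0, s)) (0, 1) := by
        rw [intervalIntegral_integral_swap hI1]
    _ = ∫ s in (0 : ℝ)..h, ∫ x, g (x + (0, s)) * φ x := by
        rw [← intervalIntegral.integral_neg]
        refine intervalIntegral.integral_congr fun s hs => ?_
        have h1 := hug.integral_eq (hφ.translate hs)
        simp only [fderiv_comp_sub] at h1
        simp only [h1, neg_neg, integral_mul_translate]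
    _ = ∫ x, (∫ s in (0 : ℝ)..h, g (x + (0, s))) * φ x := by
        rw [intervalIntegral_integral_swap hI2]
        simp only [intervalIntegral.integral_mul_const]

theorem ae_vertical_increment {H : ℝ → ℝ} (hH : IsOpen (domain H)) {u g : ℝ × ℝ → ℝ}
    (hu : Integrable u) (hg : Integrable g) (hug : IsWeakDeriv (domain H) (0, 1) u g) (h : ℝ) :
    ∀ᵐ x : ℝ × ℝ, x ∈ domain H → x + (0, h) ∈ domain H →
      u (x + (0, h)) - u x = ∫ s in (0 : ℝ)..h, g (x + (0, s)) := by
  set W : Set (ℝ × ℝ) := {x | x ∈ domain H ∧ x + (0, h) ∈ domain H} with hW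
  have hWo : IsOpen W := hH.inter (hH.preimage (by fun_prop : Continuous fun x : ℝ × ℝ => x + (0, h)))
  have hG : Integrable (fun x => ∫ s in (0 : ℝ)..h, g (x + (0, s))) := by
    have := isFiniteMeasure_restrict_uIoc 0 h
    have h1 := (measurePreserving_vertical_shear (volume.restrict (uIoc 0 h))).integrable_comp_of_integrable
      (hg.comp_snd (volume.restrict (uIoc 0 h)))
    have h2 := h1.integral_prod_right
    simp only [intervalIntegral.intervalIntegral_eq_integral_uIoc]
    exact h2.smul (if 0 ≤ h then (1 : ℝ) else -1)
  have hU : Integrable (fun x => u (x + (0, h)) - u x) := (hu.comp_add_right (0, h)).sub hu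
  have key := hWo.ae_eq_zero_of_integral_contDiff_smul_eq_zero (μ := volume)
    (f := fun x => (u (x + (0, h)) - u x) - ∫ s in (0 : ℝ)..h, g (x + (0, s)))
    ((hU.sub hG).locallyIntegrable.locallyIntegrableOn W) (fun φ h1 h2 h3 => by
      have hφ : IsTestFunction W φ := ⟨h1, h2, h3⟩
      obtain ⟨C, hC⟩ := hφ.exists_bound
      have e := integral_vertical_increment hu hg hug hφ
      have i1 := hU.mul_bdd (c := C) h1.continuous.aestronglyMeasurable (ae_of_all _ hC)
      have i2 := hG.mul_bdd (c := C) h1.continuous.aestronglyMeasurable (ae_of_all _ hC)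
      simp only [smul_eq_mul, mul_comm (φ _), sub_mul (_ - _)]
      rw [integral_sub i1 i2, e, sub_self])
  filter_upwards [key] with x hx h1 h2
  exact sub_eq_zero.1 (hx ⟨h1, h2⟩)

/-! ### Absolute continuity on vertical lines and one-dimensional estimates -/

/-- On almost every vertical line a weakly differentiable function is a primitive of its weak
derivative. -/
theorem ae_exists_eq_primitive_of_integrable {H : ℝ → ℝ} (hH : IsOpen (domain H))
    {u g : ℝ × ℝ → ℝ} (hum : StronglyMeasurable u) (hgm : StronglyMeasurable g)
    (hu : Integrable u) (hg : Integrable g) (hug : IsWeakDeriv (domain H) (0, 1) u g) :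
    ∀ᵐ a : ℝ, ∃ c : ℝ, ∀ᵐ z : ℝ, (a, z) ∈ domain H →
      u (a, z) = c + ∫ s in (0 : ℝ)..z, g (a, s) := by
  set U := domain H
  -- the primitive of `g` along vertical lines, written so that it is measurable on the plane
  set V : ℝ × ℝ → ℝ := fun x => ∫ s, ({p : (ℝ × ℝ) × ℝ | 0 < p.2 ∧ p.2 ≤ p.1.2}.indicator
    (fun p : (ℝ × ℝ) × ℝ => g (p.1.1, p.2))) (x, s) with hV
  have hVm : StronglyMeasurable V := by
    refine StronglyMeasurable.integral_prod_right (f := fun (x : ℝ × ℝ) (s : ℝ) =>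
      ({p : (ℝ × ℝ) × ℝ | 0 < p.2 ∧ p.2 ≤ p.1.2}.indicator
      (fun p : (ℝ × ℝ) × ℝ => g (p.1.1, p.2))) (x, s)) ?_
    refine StronglyMeasurable.indicator (hgm.comp_measurable (by fun_prop)) ?_
    exact (measurableSet_lt measurable_const measurable_snd).inter
      (measurableSet_le measurable_snd (by fun_prop))
  have hVeq : ∀ a z : ℝ, 0 < z → V (a, z) = ∫ s in (0 : ℝ)..z, g (a, s) := by
    intro a z hz
    rw [intervalIntegral.integral_of_le hz.le, ← integral_indicator measurableSet_Ioc]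
    rfl
  have hgi : ∀ᵐ x : ℝ × ℝ, Integrable (fun s => g (x.1, s)) :=
    Measure.quasiMeasurePreserving_fst.ae hg.prod_right_ae
  have hinc : ∀ h : ℝ, ∀ᵐ x : ℝ × ℝ, x ∈ U → x + (0, h) ∈ U →
      u (x + (0, h)) - V (x + (0, h)) = u x - V x := by
    intro h
    filter_upwards [ae_vertical_increment hH hu hg hug h, hgi] with x hx hxi h1 h2
    obtain ⟨a, y⟩ := x
    have e := hx h1 h2
    simp only [Prod.mk_add_mk, add_zero] at e h2 hxi ⊢
    rw [intervalIntegral.integral_comp_add_left (fun s => g (a, s)) y, add_zero,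
      ← intervalIntegral.integral_interval_sub_left hxi.intervalIntegrable hxi.intervalIntegrable
        (a := 0), ← hVeq a y h1.2.1, ← hVeq a _ h2.2.1] at e
    linarith
  have hmeas : MeasurableSet {p : ℝ × (ℝ × ℝ) | p.2 ∈ U → p.2 + (0, p.1) ∈ U →
      u (p.2 + (0, p.1)) - V (p.2 + (0, p.1)) = u p.2 - V p.2} := by
    have hm : Measurable (fun x => u x - V x) := hum.measurable.sub hVm.measurable
    have ht : Measurable (fun p : ℝ × (ℝ × ℝ) => p.2 + (0, p.1)) := by fun_prop
    have h1 : MeasurableSet {p : ℝ × (ℝ × ℝ) | p.2 ∈ U} := measurable_snd hH.measurableSet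
    have h2 : MeasurableSet {p : ℝ × (ℝ × ℝ) | p.2 + (0, p.1) ∈ U} := ht hH.measurableSet
    have h3 := measurableSet_eq_fun (hm.comp ht) (hm.comp measurable_snd)
    exact h1.imp (h2.imp h3)
  have hall := (Measure.ae_ae_comm (μ := (volume : Measure ℝ)) (ν := (volume : Measure (ℝ × ℝ)))
    hmeas).1 (ae_of_all _ hinc)
  filter_upwards [Measure.ae_ae_of_ae_prod hall] with a ha
  -- compare with one good point `y` on the line; without one, no good point lies in the domain
  by_cases hy : ∃ y, (a, y) ∈ U ∧ ∀ᵐ h : ℝ, (a, y) ∈ U → (a, y) + (0, h) ∈ U →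
      u ((a, y) + (0, h)) - V ((a, y) + (0, h)) = u (a, y) - V (a, y)
  · obtain ⟨y, hyU, hy⟩ := hy
    refine ⟨u (a, y) - V (a, y), ?_⟩
    filter_upwards [(measurePreserving_sub_right volume y).quasiMeasurePreserving.ae hy]
      with z hz hzU
    have := hz hyU (by simpa using hzU)
    simp only [Prod.mk_add_mk, add_zero, add_sub_cancel] at this
    rw [← hVeq a z hzU.2.1]
    linarith
  · exact ⟨0, ha.mono fun z hz hzU => absurd ⟨z, hzU, hz⟩ hy⟩

theorem domain_subset_of_le {H : ℝ → ℝ} {M : ℝ} (hM : ∀ x ∈ Ioo (0 : ℝ) 1, H x ≤ M) :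
    domain H ⊆ Ioo 0 1 ×ˢ Ioo 0 M :=
  fun _ hx => ⟨hx.1, hx.2.1, hx.2.2.trans_le (hM _ hx.1)⟩

theorem isFiniteMeasure_restrict_domain {H : ℝ → ℝ} {M : ℝ} (hM : ∀ x ∈ Ioo (0 : ℝ) 1, H x ≤ M) :
    IsFiniteMeasure (volume.restrict (domain H)) := by
  refine ⟨?_⟩
  rw [Measure.restrict_apply_univ]
  refine (measure_mono (domain_subset_of_le hM)).trans_lt ?_
  rw [Measure.volume_eq_prod, Measure.prod_prod]
  simp

theorem H1.ae_exists_eq_primitive {H : ℝ → ℝ} {M : ℝ} (hH : IsOpen (domain H))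
    (hM : ∀ x ∈ Ioo (0 : ℝ) 1, H x ≤ M) (w : H1 (domain H)) :
    ∀ᵐ a : ℝ, ∃ c : ℝ, ∀ᵐ z : ℝ, (a, z) ∈ domain H →
      w.val (a, z) = c + ∫ s in (0 : ℝ)..z, w.d₂ (a, s) := by
  have := isFiniteMeasure_restrict_domain hM
  have hm := hH.measurableSet
  have hu := w.memLp_val.1
  have hg := w.memLp_d₂.1
  have eu := (ae_restrict_iff' hm).1 hu.ae_eq_mk
  have eg := (ae_restrict_iff' hm).1 hg.ae_eq_mk
  have key := ae_exists_eq_primitive_of_integrable hH (u := (domain H).indicator (hu.mk _))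
    (g := (domain H).indicator (hg.mk _)) (hu.stronglyMeasurable_mk.indicator hm)
    (hg.stronglyMeasurable_mk.indicator hm)
    ((integrable_indicator_iff hm).2
      ((w.memLp_val.integrable one_le_two).congr hu.ae_eq_mk))
    ((integrable_indicator_iff hm).2
      ((w.memLp_d₂.integrable one_le_two).congr hg.ae_eq_mk))
    (fun φ hφ => by
      have h1 := w.weak_d₂ φ hφ
      have e1 : ∫ x in domain H, (domain H).indicator (hu.mk _) x * fderiv ℝ φ x (0, 1)
          = ∫ x in domain H, w.val x * fderiv ℝ φ x (0, 1) :=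
        setIntegral_congr_ae hm (eu.mono fun x hx hxU => by rw [indicator_of_mem hxU, hx hxU])
      have e2 : ∫ x in domain H, (domain H).indicator (hg.mk _) x * φ x
          = ∫ x in domain H, w.d₂ x * φ x :=
        setIntegral_congr_ae hm (eg.mono fun x hx hxU => by rw [indicator_of_mem hxU, hx hxU])
      rw [e1, e2, h1])
  filter_upwards [key, Measure.ae_ae_of_ae_prod eu, Measure.ae_ae_of_ae_prod eg]
    with a ⟨c, hc⟩ hau hag
  refine ⟨c, ?_⟩
  filter_upwards [hc, hau] with z hz hzu hzU
  have h1 := hz hzU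
  rw [indicator_of_mem hzU, ← hzu hzU] at h1
  rw [h1]
  congr 1
  refine intervalIntegral.integral_congr_ae ?_
  filter_upwards [hag] with s hs hsz
  rw [uIoc_of_le hzU.2.1.le] at hsz
  have hsU : (a, s) ∈ domain H := ⟨hzU.1, hsz.1, hsz.2.trans_lt hzU.2.2⟩
  rw [indicator_of_mem hsU, hs hsU]

/-- The Cauchy–Schwarz inequality for real integrals. -/
theorem sq_integral_mul_le {α : Type*} [MeasurableSpace α] {μ : Measure α} {f g : α → ℝ}
    (hf : Integrable (fun x => f x ^ 2) μ) (hg : Integrable (fun x => g x ^ 2) μ)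
    (hfg : Integrable (fun x => f x * g x) μ) :
    (∫ x, f x * g x ∂μ) ^ 2 ≤ (∫ x, f x ^ 2 ∂μ) * ∫ x, g x ^ 2 ∂μ := by
  have h : ∀ t : ℝ, 0 ≤ (∫ x, g x ^ 2 ∂μ) * (t * t) + (-(2 * ∫ x, f x * g x ∂μ)) * t
      + ∫ x, f x ^ 2 ∂μ := by
    intro t
    have h0 : 0 ≤ ∫ x, (f x - t * g x) ^ 2 ∂μ := integral_nonneg fun x => sq_nonneg _
    have e : (fun x => (f x - t * g x) ^ 2)
        = fun x => f x ^ 2 - 2 * t * (f x * g x) + t ^ 2 * g x ^ 2 := by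
      funext x; ring
    have hs : Integrable (fun x => f x ^ 2 - 2 * t * (f x * g x)) μ := hf.sub (hfg.const_mul _)
    rw [e, integral_add hs (hg.const_mul _), integral_sub hf (hfg.const_mul _), integral_const_mul, integral_const_mul] at h0
    linarith
  have := discrim_le_zero h
  simp only [discrim] at this
  linarith

theorem sq_intervalIntegral_le {q : ℝ → ℝ} {a b L : ℝ} (ha : 0 ≤ a) (hab : a ≤ b) (hb : b < L)
    (hq : IntegrableOn q (Ioo 0 L)) (hq2 : IntegrableOn (fun s => q s ^ 2) (Ioo 0 L)) :
    (∫ s in a..b, q s) ^ 2 ≤ (b - a) * ∫ s in Ioo 0 L, q s ^ 2 := by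
  have hs : Ioc a b ⊆ Ioo 0 L := fun s hs => ⟨ha.trans_lt hs.1, hs.2.trans_lt hb⟩
  rw [intervalIntegral.integral_of_le hab]
  have h := sq_integral_mul_le (μ := volume.restrict (Ioc a b)) (f := fun _ => (1 : ℝ)) (g := q)
    (by simp) (hq2.mono_set hs) (by simp only [one_mul]; exact hq.mono_set hs)
  simp only [one_mul, one_pow, integral_const, measureReal_restrict_apply_univ, smul_eq_mul,
    mul_one, Real.volume_real_Ioc_of_le hab] at h
  refine h.trans (mul_le_mul_of_nonneg_left ?_ (by linarith))
  exact setIntegral_mono_set hq2 (ae_of_all _ fun s => sq_nonneg _) (ae_of_all _ hs)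

/-- A one-dimensional Sobolev inequality: a primitive of `q` on `(0, L)` is bounded by its mean
square and that of `q`. -/
theorem sq_le_of_ae_eq_primitive {p q : ℝ → ℝ} {c L : ℝ} (hL : 0 < L)
    (hq : IntegrableOn q (Ioo 0 L)) (hq2 : IntegrableOn (fun s => q s ^ 2) (Ioo 0 L))
    (hp2 : IntegrableOn (fun s => p s ^ 2) (Ioo 0 L))
    (hpq : ∀ᵐ z, z ∈ Ioo 0 L → p z = c + ∫ s in (0 : ℝ)..z, q s) :
    ∀ᵐ z, z ∈ Ioo 0 L →
      p z ^ 2 ≤ 2 / L * (∫ s in Ioo 0 L, p s ^ 2) + 2 * L * ∫ s in Ioo 0 L, q s ^ 2 := by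
  filter_upwards [hpq] with z hz hzL
  have hint : ∀ t ∈ Ioo 0 L, IntervalIntegrable q volume 0 t := fun t ht => by
    rw [intervalIntegrable_iff_integrableOn_Ioc_of_le ht.1.le]
    exact hq.mono_set fun s hs => ⟨hs.1, hs.2.trans_lt ht.2⟩
  have hQ : 0 ≤ ∫ s in Ioo 0 L, q s ^ 2 := integral_nonneg fun s => sq_nonneg _
  -- compare with the value at another point `y`, then average over `y`
  have hcmp : ∀ᵐ y, y ∈ Ioo 0 L → p z ^ 2 ≤ 2 * p y ^ 2 + 2 * L * ∫ s in Ioo 0 L, q s ^ 2 := by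
    filter_upwards [hpq] with y hy hyL
    have hd : (p z - p y) ^ 2 ≤ L * ∫ s in Ioo 0 L, q s ^ 2 := by
      rw [hz hzL, hy hyL, add_sub_add_left_eq_sub,
        intervalIntegral.integral_interval_sub_left (hint z hzL) (hint y hyL)]
      rcases le_total y z with h | h
      · refine (sq_intervalIntegral_le hyL.1.le h hzL.2 hq hq2).trans ?_
        exact mul_le_mul_of_nonneg_right (by linarith [hyL.1, hzL.2]) hQ
      · rw [intervalIntegral.integral_symm, neg_sq]
        refine (sq_intervalIntegral_le hzL.1.le h hyL.2 hq hq2).trans ?_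
        exact mul_le_mul_of_nonneg_right (by linarith [hzL.1, hyL.2]) hQ
    nlinarith [sq_nonneg (p z - 2 * p y)]
  have hconst : ∀ k : ℝ, IntegrableOn (fun _ => k) (Ioo 0 L) := fun k =>
    integrableOn_const (by simp)
  have hm := setIntegral_mono_on_ae (hconst (p z ^ 2)) ((hp2.const_mul 2).add (hconst _))
    measurableSet_Ioo hcmp
  rw [integral_add' (hp2.const_mul 2) (hconst _), integral_const_mul, setIntegral_const,
    setIntegral_const, Real.volume_real_Ioo_of_le hL.le] at hm
  simp only [sub_zero, smul_eq_mul] at hm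
  have h3 : p z ^ 2 ≤ (2 * (∫ s in Ioo 0 L, p s ^ 2)
      + L * (2 * L * ∫ s in Ioo 0 L, q s ^ 2)) / L := by
    rw [le_div_iff₀ hL]; linarith
  refine h3.trans (le_of_eq ?_)
  field_simp

theorem quasiMeasurePreserving_div_const {l : ℝ} (hl : l ≠ 0) :
    Measure.QuasiMeasurePreserving (fun z : ℝ => z / l) volume volume := by
  refine ⟨by fun_prop, ?_⟩
  simp only [div_eq_mul_inv]
  rw [Real.map_volume_mul_right (inv_ne_zero hl)]
  exact Measure.smul_absolutelyContinuous

/-- A primitive of `q` is close to its dilations, being Hölder continuous of exponent `1/2`. -/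
theorem sq_sub_dilation_le_of_ae_eq_primitive {p q : ℝ → ℝ} {c L l : ℝ} (hl : 1 ≤ l)
    (hq : IntegrableOn q (Ioo 0 L)) (hq2 : IntegrableOn (fun s => q s ^ 2) (Ioo 0 L))
    (hpq : ∀ᵐ z, z ∈ Ioo 0 L → p z = c + ∫ s in (0 : ℝ)..z, q s) :
    ∀ᵐ z, z ∈ Ioo 0 L →
      (p (z / l) - p z) ^ 2 ≤ L * (l - 1) * ∫ s in Ioo 0 L, q s ^ 2 := by
  have hl0 : 0 < l := by linarith
  have hqmp := quasiMeasurePreserving_div_const hl0.ne'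
  filter_upwards [hpq, hqmp.ae hpq] with z hz hzl hzL
  have hle : z / l ≤ z := div_le_self hzL.1.le hl
  have hzlL : z / l ∈ Ioo 0 L := ⟨div_pos hzL.1 hl0, hle.trans_lt hzL.2⟩
  have hint : ∀ t ∈ Ioo 0 L, IntervalIntegrable q volume 0 t := fun t ht => by
    rw [intervalIntegrable_iff_integrableOn_Ioc_of_le ht.1.le]
    exact hq.mono_set fun s hs => ⟨hs.1, hs.2.trans_lt ht.2⟩
  have hQ : 0 ≤ ∫ s in Ioo 0 L, q s ^ 2 := integral_nonneg fun s => sq_nonneg _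
  rw [hz hzL, hzl hzlL, add_sub_add_left_eq_sub,
    intervalIntegral.integral_interval_sub_left (hint _ hzlL) (hint z hzL),
    intervalIntegral.integral_symm, neg_sq]
  refine (sq_intervalIntegral_le hzlL.1.le hle hzL.2 hq hq2).trans
    (mul_le_mul_of_nonneg_right ?_ hQ)
  have e : z - z / l = z / l * (l - 1) := by field_simp
  rw [e]
  exact mul_le_mul_of_nonneg_right hzlL.2.le (by linarith)

/-! ### Profiles, and operations on `H¹` functions -/

theorem IsProfile.eventually_lt {G₀ G₁ c a : ℝ} {G : ℝ → ℝ} (hG : IsProfile G₀ G₁ G)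
    (ha : a ∈ Ioo (0 : ℝ) 1) (hc : c < G a) : ∀ᶠ b in 𝓝 a, c < G b := by
  obtain ⟨⟨l, hl⟩, -⟩ := hG.piecewiseC1.left_limits a ⟨ha.1, ha.2.le⟩
  obtain ⟨⟨r, hr⟩, -⟩ := hG.piecewiseC1.right_limits a ⟨ha.1.le, ha.2⟩
  have hm := hG.minAtJumps a ha l r hl hr
  rw [hm, lt_min_iff] at hc
  have h : ∀ᶠ b in 𝓝[≠] a, c < G b := by
    rw [← nhdsLT_sup_nhdsGT, eventually_sup]
    exact ⟨hl.eventually_const_lt hc.1, hr.eventually_const_lt hc.2⟩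
  rw [eventually_nhdsWithin_iff] at h
  filter_upwards [h] with b hb
  by_cases hba : b = a
  · rw [hba, hm]; exact lt_min hc.1 hc.2
  · exact hb hba

/-- The value taken at jumps makes a profile lower semicontinuous, so its subgraph is open. -/
theorem IsProfile.isOpen_domain {G₀ G₁ : ℝ} {G : ℝ → ℝ} (hG : IsProfile G₀ G₁ G) :
    IsOpen (domain G) := by
  rw [isOpen_iff_mem_nhds]
  rintro ⟨a, z⟩ ⟨ha, hz, hzG⟩
  obtain ⟨c, hzc, hcG⟩ := exists_between hzG
  have h1 : ∀ᶠ y : ℝ × ℝ in 𝓝 (a, z), c < G y.1 :=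
    continuous_fst.continuousAt.eventually (hG.eventually_lt ha hcG)
  have h2 : ∀ᶠ y : ℝ × ℝ in 𝓝 (a, z), y.1 ∈ Ioo (0 : ℝ) 1 :=
    continuous_fst.continuousAt.eventually (isOpen_Ioo.mem_nhds ha)
  have h3 : ∀ᶠ y : ℝ × ℝ in 𝓝 (a, z), y.2 ∈ Ioo 0 c :=
    continuous_snd.continuousAt.eventually (isOpen_Ioo.mem_nhds ⟨hz, hzc⟩)
  filter_upwards [h1, h2, h3] with y h1 h2 h3
  exact ⟨h2, h3.1, h3.2.trans h1⟩

/-- The essential bound between two profiles holds at every point: it passes to the one-sided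
limits, and these determine the values. -/
theorem IsProfile.abs_sub_le {G₀ G₁ : ℝ} {G G' : ℝ → ℝ} (hG : IsProfile G₀ G₁ G)
    (hG' : IsProfile G₀ G₁ G') {δ : ℝ≥0}
    (hδ : eLpNorm (fun x => G x - G' x) ∞ (volume.restrict (Ioo (0 : ℝ) 1)) ≤ (δ : ℝ≥0∞))
    {a : ℝ} (ha : a ∈ Ioo (0 : ℝ) 1) : |G a - G' a| ≤ δ := by
  have hae : ∀ᵐ x, x ∈ Ioo (0 : ℝ) 1 → |G x - G' x| ≤ δ := by
    rw [← ae_restrict_iff' measurableSet_Ioo]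
    rw [eLpNorm_exponent_top] at hδ
    filter_upwards [ae_le_eLpNormEssSup (f := fun x => G x - G' x)
      (μ := volume.restrict (Ioo (0 : ℝ) 1))] with x hx
    have h := hx.trans hδ
    rw [enorm_le_coe] at h
    exact_mod_cast h
  have hdense := Measure.dense_of_ae hae
  obtain ⟨⟨l, hl⟩, -⟩ := hG.piecewiseC1.left_limits a ⟨ha.1, ha.2.le⟩
  obtain ⟨⟨r, hr⟩, -⟩ := hG.piecewiseC1.right_limits a ⟨ha.1.le, ha.2⟩
  obtain ⟨⟨l', hl'⟩, -⟩ := hG'.piecewiseC1.left_limits a ⟨ha.1, ha.2.le⟩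
  obtain ⟨⟨r', hr'⟩, -⟩ := hG'.piecewiseC1.right_limits a ⟨ha.1.le, ha.2⟩
  have hL : ∃ᶠ x in 𝓝[<] a, |G x - G' x| ≤ δ := by
    intro h
    obtain ⟨c, hc, hcs⟩ := (mem_nhdsLT_iff_exists_Ioo_subset' ha.1).1
      (inter_mem h (Ioo_mem_nhdsLT ha.1))
    obtain ⟨x, hx, hxc⟩ := hdense.exists_between hc
    exact (hcs hxc).1 (hx ⟨(hcs hxc).2.1, (hcs hxc).2.2.trans ha.2⟩)
  have hR : ∃ᶠ x in 𝓝[>] a, |G x - G' x| ≤ δ := by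
    intro h
    obtain ⟨c, hc, hcs⟩ := (mem_nhdsGT_iff_exists_Ioo_subset' ha.2).1
      (inter_mem h (Ioo_mem_nhdsGT ha.2))
    obtain ⟨x, hx, hxc⟩ := hdense.exists_between hc
    exact (hcs hxc).1 (hx ⟨ha.1.trans (hcs hxc).2.1, (hcs hxc).2.2⟩)
  rw [hG.minAtJumps a ha l r hl hr, hG'.minAtJumps a ha l' r' hl' hr']
  exact (abs_min_sub_min_le_max _ _ _ _).trans (max_le
    (le_of_tendsto_of_frequently (hl.sub hl').abs hL)
    (le_of_tendsto_of_frequently (hr.sub hr').abs hR))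

theorem domain_inter_domain (G G' : ℝ → ℝ) :
    domain G ∩ domain G' = domain (fun x => min (G x) (G' x)) := by
  ext x
  simp only [domain, mem_inter_iff, mem_ofPred_eq, lt_min_iff]
  tauto

theorem IsTestFunction.mono {U V : Set (ℝ × ℝ)} {φ : ℝ × ℝ → ℝ} (hφ : IsTestFunction V φ)
    (hVU : V ⊆ U) : IsTestFunction U φ :=
  ⟨hφ.smooth, hφ.compact, hφ.support.trans hVU⟩

theorem IsTestFunction.integrable_mul {U : Set (ℝ × ℝ)} {k φ : ℝ × ℝ → ℝ}
    (hφ : IsTestFunction U φ) (hk : MemLp k 2 (volume.restrict U)) :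
    IntegrableOn (fun x => k x * φ x) U :=
  hk.integrable_mul (q := 2)
    ((hφ.smooth.continuous.memLp_of_hasCompactSupport hφ.compact (μ := volume)).restrict U)

theorem IsTestFunction.integrable_mul_fderiv {U : Set (ℝ × ℝ)} {k φ : ℝ × ℝ → ℝ}
    (hφ : IsTestFunction U φ) (hk : MemLp k 2 (volume.restrict U)) (v : ℝ × ℝ) :
    IntegrableOn (fun x => k x * fderiv ℝ φ x v) U := by
  have hc : Continuous (fun x => fderiv ℝ φ x v) :=
    (hφ.smooth.continuous_fderiv (by simp)).clm_apply continuous_const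
  have hs : HasCompactSupport (fun x => fderiv ℝ φ x v) :=
    hφ.compact.mono' (subset_closure.trans (tsupport_fderiv_apply_subset φ v))
  exact hk.integrable_mul (q := 2) ((hc.memLp_of_hasCompactSupport hs (μ := volume)).restrict U)

theorem IsWeakDeriv.mono {U V : Set (ℝ × ℝ)} {v : ℝ × ℝ} {u g : ℝ × ℝ → ℝ}
    (h : IsWeakDeriv U v u g) (hVU : V ⊆ U) : IsWeakDeriv V v u g := by
  intro φ hφ
  rw [setIntegral_eq_integral_of_tsupport_subset hφ.support,
    setIntegral_eq_integral_of_tsupport_subset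
      ((tsupport_fderiv_apply_subset φ v).trans hφ.support)]
  exact h.integral_eq (hφ.mono hVU)

/-- The restriction of an `H¹` function to a smaller set. -/
noncomputable def H1.restrict {U V : Set (ℝ × ℝ)} (w : H1 U) (hVU : V ⊆ U) : H1 V where
  val := w.val
  d₁ := w.d₁
  d₂ := w.d₂
  memLp_val := w.memLp_val.mono_measure (Measure.restrict_mono_set _ hVU)
  memLp_d₁ := w.memLp_d₁.mono_measure (Measure.restrict_mono_set _ hVU)
  memLp_d₂ := w.memLp_d₂.mono_measure (Measure.restrict_mono_set _ hVU)
  weak_d₁ := w.weak_d₁.mono hVU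
  weak_d₂ := w.weak_d₂.mono hVU

theorem IsWeakDeriv.midpoint {U : Set (ℝ × ℝ)} {v : ℝ × ℝ} {u u' g g' : ℝ × ℝ → ℝ}
    (h : IsWeakDeriv U v u g) (h' : IsWeakDeriv U v u' g')
    (hu : MemLp u 2 (volume.restrict U)) (hu' : MemLp u' 2 (volume.restrict U))
    (hg : MemLp g 2 (volume.restrict U)) (hg' : MemLp g' 2 (volume.restrict U)) :
    IsWeakDeriv U v (fun x => 1 / 2 * (u x + u' x)) (fun x => 1 / 2 * (g x + g' x)) := by
  intro φ hφ
  simp only [mul_assoc, add_mul, integral_const_mul]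
  rw [integral_add (hφ.integrable_mul_fderiv hu v) (hφ.integrable_mul_fderiv hu' v),
    integral_add (hφ.integrable_mul hg) (hφ.integrable_mul hg'), h φ hφ, h' φ hφ]
  ring

/-- The midpoint of two `H¹` functions. -/
noncomputable def H1.midpoint {U : Set (ℝ × ℝ)} (u w : H1 U) : H1 U where
  val := fun x => 1 / 2 * (u.val x + w.val x)
  d₁ := fun x => 1 / 2 * (u.d₁ x + w.d₁ x)
  d₂ := fun x => 1 / 2 * (u.d₂ x + w.d₂ x)
  memLp_val := (u.memLp_val.add w.memLp_val).const_mul (1 / 2)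
  memLp_d₁ := (u.memLp_d₁.add w.memLp_d₁).const_mul (1 / 2)
  memLp_d₂ := (u.memLp_d₂.add w.memLp_d₂).const_mul (1 / 2)
  weak_d₁ := u.weak_d₁.midpoint w.weak_d₁ u.memLp_val w.memLp_val u.memLp_d₁ w.memLp_d₁
  weak_d₂ := u.weak_d₂.midpoint w.weak_d₂ u.memLp_val w.memLp_val u.memLp_d₂ w.memLp_d₂

/-- The vertical dilation `(x₁, x₂) ↦ (x₁, l x₂)`. -/
noncomputable def stretch (l : ℝ) (hl : l ≠ 0) : (ℝ × ℝ) ≃L[ℝ] (ℝ × ℝ) :=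
  (ContinuousLinearEquiv.refl ℝ ℝ).prodCongr (ContinuousLinearEquiv.smulLeft (Units.mk0 l hl))

theorem stretch_apply {l : ℝ} (hl : l ≠ 0) (x : ℝ × ℝ) : stretch l hl x = (x.1, l * x.2) := rfl

theorem measurePreserving_shrink {l : ℝ} (hl : 0 < l) :
    MeasurePreserving (fun x : ℝ × ℝ => (x.1, x.2 / l)) volume (ENNReal.ofReal l • volume) := by
  refine ⟨by fun_prop, ?_⟩
  have h := (Measure.map_prod_map (volume : Measure ℝ) (volume : Measure ℝ)
    (f := fun x : ℝ => x) (g := fun x : ℝ => x / l) measurable_id (by fun_prop)).symm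
  simp only [div_eq_mul_inv] at h ⊢
  rw [Real.map_volume_mul_right (inv_ne_zero hl.ne'), inv_inv, abs_of_pos hl,
    Measure.map_id', Measure.prod_smul_right] at h
  exact h

theorem measurableEmbedding_shrink {l : ℝ} (hl : 0 < l) :
    MeasurableEmbedding (fun x : ℝ × ℝ => (x.1, x.2 / l)) := by
  refine Measurable.measurableEmbedding (by fun_prop) fun x y h => ?_
  simp only [Prod.mk.injEq, div_left_inj' hl.ne'] at h
  exact Prod.ext h.1 h.2

theorem integral_comp_shrink {l : ℝ} (hl : 0 < l) (F : ℝ × ℝ → ℝ) :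
    ∫ x : ℝ × ℝ, F (x.1, x.2 / l) = l * ∫ x, F x := by
  rw [(measurePreserving_shrink hl).integral_comp (measurableEmbedding_shrink hl) F,
    integral_smul_measure, ENNReal.toReal_ofReal hl.le, smul_eq_mul]

theorem memLp_comp_shrink {l : ℝ} (hl : 0 < l) {U V : Set (ℝ × ℝ)} {k : ℝ × ℝ → ℝ}
    (hU : MeasurableSet U) (hVU : ∀ x ∈ V, (x.1, x.2 / l) ∈ U)
    (hk : MemLp k 2 (volume.restrict U)) :
    MemLp (fun x => k (x.1, x.2 / l)) 2 (volume.restrict V) := by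
  have h1 := (measurePreserving_shrink hl).restrict_preimage hU
  rw [Measure.restrict_smul] at h1
  have h2 := (hk.smul_measure ENNReal.ofReal_ne_top).comp_measurePreserving h1
  exact h2.mono_measure (Measure.restrict_mono_set _ hVU)

theorem IsTestFunction.comp_stretch {l : ℝ} (hl : 0 < l) {U V : Set (ℝ × ℝ)} {φ : ℝ × ℝ → ℝ}
    (hVU : ∀ x ∈ V, (x.1, x.2 / l) ∈ U) (hφ : IsTestFunction V φ) :
    IsTestFunction U (φ ∘ stretch l hl.ne') := by
  refine ⟨hφ.smooth.comp (stretch l hl.ne').contDiff,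
    hφ.compact.comp_homeomorph (stretch l hl.ne').toHomeomorph, ?_⟩
  have hts : tsupport (φ ∘ stretch l hl.ne') = (stretch l hl.ne') ⁻¹' tsupport φ :=
    tsupport_comp_eq_preimage φ (stretch l hl.ne').toHomeomorph
  rw [hts]
  intro x hx
  have := hVU _ (hφ.support hx)
  rw [stretch_apply] at this
  simpa [mul_div_cancel_left₀ _ hl.ne'] using this

/-- Weak derivatives of `x ↦ u (x₁, x₂ / l)` in a direction `v` that the dilation multiplies by `c`. -/
theorem IsWeakDeriv.comp_shrink {l c : ℝ} (hl : 0 < l) (hc : c ≠ 0) {U V : Set (ℝ × ℝ)}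
    {v : ℝ × ℝ} (hv : stretch l hl.ne' v = c • v) {u g : ℝ × ℝ → ℝ}
    (hVU : ∀ x ∈ V, (x.1, x.2 / l) ∈ U) (h : IsWeakDeriv U v u g) :
    IsWeakDeriv V v (fun x => u (x.1, x.2 / l)) (fun x => c⁻¹ * g (x.1, x.2 / l)) := by
  intro φ hφ
  have h1 := h.integral_eq (hφ.comp_stretch hl hVU)
  simp only [ContinuousLinearEquiv.comp_right_fderiv, ContinuousLinearMap.comp_apply,
    ContinuousLinearEquiv.coe_coe, hv, map_smul, smul_eq_mul, Function.comp_apply] at h1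
  have hs : ∀ x : ℝ × ℝ, stretch l hl.ne' (x.1, x.2 / l) = x := fun x => by
    rw [stretch_apply, mul_div_cancel₀ _ hl.ne']
  have e1 := integral_comp_shrink hl (fun y => u y * fderiv ℝ φ (stretch l hl.ne' y) v)
  have e2 := integral_comp_shrink hl (fun y => g y * φ (stretch l hl.ne' y))
  simp only [hs] at e1 e2
  rw [setIntegral_eq_integral_of_tsupport_subset hφ.support,
    setIntegral_eq_integral_of_tsupport_subset
      ((tsupport_fderiv_apply_subset φ v).trans hφ.support), e1]
  simp only [mul_assoc, integral_const_mul, e2]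
  have h2 : c * ∫ y, u y * fderiv ℝ φ (stretch l hl.ne' y) v
      = -∫ y, g y * φ (stretch l hl.ne' y) := by
    rw [← h1, ← integral_const_mul]
    exact integral_congr_ae (ae_of_all _ fun x => by ring)
  field_simp
  linear_combination h2

/-- The vertical dilation `(x₁, x₂) ↦ w (x₁, x₂ / l)` of an `H¹` function, on any set that the
inverse dilation maps into the domain of `w`. As the factor `l` does not depend on `x₁`, the
horizontal derivative is merely transported. -/
noncomputable def H1.dilate {U V : Set (ℝ × ℝ)} (w : H1 U) {l : ℝ} (hl : 0 < l) (hU : MeasurableSet U)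
    (hVU : ∀ x ∈ V, (x.1, x.2 / l) ∈ U) : H1 V where
  val := fun x => w.val (x.1, x.2 / l)
  -- the factor `1⁻¹` matches the general form of `IsWeakDeriv.comp_shrink`
  d₁ := fun x => 1⁻¹ * w.d₁ (x.1, x.2 / l)
  d₂ := fun x => l⁻¹ * w.d₂ (x.1, x.2 / l)
  memLp_val := memLp_comp_shrink hl hU hVU w.memLp_val
  memLp_d₁ := (memLp_comp_shrink hl hU hVU w.memLp_d₁).const_mul _
  memLp_d₂ := (memLp_comp_shrink hl hU hVU w.memLp_d₂).const_mul _
  weak_d₁ := w.weak_d₁.comp_shrink hl one_ne_zero (by simp [stretch_apply]) hVU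
  weak_d₂ := w.weak_d₂.comp_shrink hl hl.ne' (by simp [stretch_apply]) hVU

theorem setIntegral_comp_shrink_le {l : ℝ} (hl : 0 < l) {U V : Set (ℝ × ℝ)} {k : ℝ × ℝ → ℝ}
    (hU : MeasurableSet U) (hVU : ∀ x ∈ V, (x.1, x.2 / l) ∈ U)
    (hk : MemLp k 2 (volume.restrict U)) :
    ∫ x in V, k (x.1, x.2 / l) ^ 2 ≤ l * ∫ x in U, k x ^ 2 := by
  rw [← integral_indicator hU, ← integral_comp_shrink hl]
  have e : (fun x : ℝ × ℝ => U.indicator (fun x => k x ^ 2) (x.1, x.2 / l))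
      = ((fun x : ℝ × ℝ => (x.1, x.2 / l)) ⁻¹' U).indicator (fun x => k (x.1, x.2 / l) ^ 2) := rfl
  have hpre : MeasurableSet ((fun x : ℝ × ℝ => (x.1, x.2 / l)) ⁻¹' U) :=
    (measurePreserving_shrink hl).measurable hU
  rw [e, integral_indicator hpre]
  refine setIntegral_mono_set ?_ (ae_of_all _ fun x => sq_nonneg _) (ae_of_all _ hVU)
  exact (memLp_comp_shrink hl hU (fun x hx => hx) hk).integrable_sq

/-! ### Integration over vertical lines -/

theorem integral_slice_indicator {H : ℝ → ℝ} {a : ℝ} (ha : a ∈ Ioo (0 : ℝ) 1) (F : ℝ × ℝ → ℝ) :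
    ∫ z, (domain H).indicator F (a, z) = ∫ z in Ioo 0 (H a), F (a, z) := by
  rw [← integral_indicator measurableSet_Ioo]
  refine integral_congr_ae (ae_of_all _ fun z => ?_)
  beta_reduce
  by_cases hz : z ∈ Ioo 0 (H a)
  · rw [indicator_of_mem hz, indicator_of_mem (show (a, z) ∈ domain H from ⟨ha, hz.1, hz.2⟩)]
  · rw [indicator_of_notMem hz,
      indicator_of_notMem (show (a, z) ∉ domain H from fun h => hz ⟨h.2.1, h.2.2⟩)]

theorem ae_integrableOn_slice {H : ℝ → ℝ} (hm : MeasurableSet (domain H)) {F : ℝ × ℝ → ℝ}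
    (hF : IntegrableOn F (domain H)) :
    ∀ᵐ a : ℝ, a ∈ Ioo (0 : ℝ) 1 → IntegrableOn (fun z => F (a, z)) (Ioo 0 (H a)) := by
  have h := ((integrable_indicator_iff hm).2 hF).prod_right_ae
  filter_upwards [h] with a ha ha'
  refine (ha.integrableOn (s := Ioo 0 (H a))).congr_fun (fun z hz => ?_) measurableSet_Ioo
  exact indicator_of_mem (show (a, z) ∈ domain H from ⟨ha', hz.1, hz.2⟩) F

theorem integrable_integral_slice {A : Set (ℝ × ℝ)} (hm : MeasurableSet A) {F : ℝ × ℝ → ℝ}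
    (hF : IntegrableOn F A) : Integrable (fun a => ∫ z, A.indicator F (a, z)) :=
  ((integrable_indicator_iff hm).2 hF).integral_prod_left

theorem integral_integral_slice {A : Set (ℝ × ℝ)} (hm : MeasurableSet A) {F : ℝ × ℝ → ℝ}
    (hF : IntegrableOn F A) : ∫ a, ∫ z, A.indicator F (a, z) = ∫ x in A, F x := by
  rw [← integral_indicator hm]
  exact (integral_prod _ ((integrable_indicator_iff hm).2 hF)).symm

/-- The majorant, on the vertical line over `a`, of the square of an `H¹` function. -/
noncomputable def sliceBound {H : ℝ → ℝ} (G₀ M : ℝ) (w : H1 (domain H)) (a : ℝ) : ℝ :=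
  2 / G₀ * (∫ z, (domain H).indicator (fun x => w.val x ^ 2) (a, z))
    + 2 * M * ∫ z, (domain H).indicator (fun x => w.d₂ x ^ 2) (a, z)

section Slices

variable {H : ℝ → ℝ} {G₀ M : ℝ} (hH : IsOpen (domain H)) (hG₀ : 0 < G₀)
  (hlow : ∀ x ∈ Ioo (0 : ℝ) 1, G₀ ≤ H x) (hM : ∀ x ∈ Ioo (0 : ℝ) 1, H x ≤ M)
  (w : H1 (domain H))

theorem indicator_sq_integral_nonneg (A : Set (ℝ × ℝ)) (k : ℝ × ℝ → ℝ) (a : ℝ) :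
    0 ≤ ∫ z, A.indicator (fun x => k x ^ 2) (a, z) :=
  integral_nonneg fun _ => indicator_nonneg (fun _ _ => sq_nonneg _) _

include hH hM in
theorem H1.ae_integrableOn_slice_d₂ :
    ∀ᵐ a : ℝ, a ∈ Ioo (0 : ℝ) 1 → IntegrableOn (fun z => w.d₂ (a, z)) (Ioo 0 (H a)) := by
  have := isFiniteMeasure_restrict_domain hM
  exact ae_integrableOn_slice hH.measurableSet (w.memLp_d₂.integrable one_le_two)

include hH hG₀ hlow hM in
theorem H1.ae_sq_le_sliceBound :
    ∀ᵐ a : ℝ, ∀ᵐ z : ℝ, (a, z) ∈ domain H → w.val (a, z) ^ 2 ≤ sliceBound G₀ M w a := by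
  filter_upwards [w.ae_exists_eq_primitive hH hM, w.ae_integrableOn_slice_d₂ hH hM,
    ae_integrableOn_slice hH.measurableSet w.memLp_d₂.integrable_sq,
    ae_integrableOn_slice hH.measurableSet w.memLp_val.integrable_sq] with a ⟨c, hc⟩ h1 h2 h3
  by_cases ha : a ∈ Ioo (0 : ℝ) 1
  · have hL : 0 < H a := hG₀.trans_le (hlow a ha)
    filter_upwards [sq_le_of_ae_eq_primitive (p := fun z => w.val (a, z)) hL (h1 ha) (h2 ha) (h3 ha)
      (hc.mono fun z hz hzL => hz ⟨ha, hzL.1, hzL.2⟩)] with z hz hzU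
    refine (hz ⟨hzU.2.1, hzU.2.2⟩).trans ?_
    rw [sliceBound, integral_slice_indicator ha, integral_slice_indicator ha]
    have i1 : 0 ≤ ∫ s in Ioo 0 (H a), w.val (a, s) ^ 2 := integral_nonneg fun s => sq_nonneg _
    have i2 : 0 ≤ ∫ s in Ioo 0 (H a), w.d₂ (a, s) ^ 2 := integral_nonneg fun s => sq_nonneg _
    have := hlow a ha
    have := hM a ha
    gcongr
  · exact ae_of_all _ fun z hz => absurd hz.1 ha

include hH hM in
theorem H1.ae_sq_dilate_sub_le {l : ℝ} (hl : 1 ≤ l) :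
    ∀ᵐ a : ℝ, ∀ᵐ z : ℝ, (a, z) ∈ domain H → (w.val (a, z / l) - w.val (a, z)) ^ 2
      ≤ M * (l - 1) * ∫ z, (domain H).indicator (fun x => w.d₂ x ^ 2) (a, z) := by
  filter_upwards [w.ae_exists_eq_primitive hH hM, w.ae_integrableOn_slice_d₂ hH hM,
    ae_integrableOn_slice hH.measurableSet w.memLp_d₂.integrable_sq] with a ⟨c, hc⟩ h1 h2
  by_cases ha : a ∈ Ioo (0 : ℝ) 1
  · filter_upwards [sq_sub_dilation_le_of_ae_eq_primitive (p := fun z => w.val (a, z)) hl (h1 ha)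
      (h2 ha) (hc.mono fun z hz hzL => hz ⟨ha, hzL.1, hzL.2⟩)] with z hz hzU
    refine (hz ⟨hzU.2.1, hzU.2.2⟩).trans ?_
    rw [integral_slice_indicator ha]
    have i2 : 0 ≤ ∫ s in Ioo 0 (H a), w.d₂ (a, s) ^ 2 := integral_nonneg fun s => sq_nonneg _
    have := hM a ha
    have : 0 ≤ l - 1 := by linarith
    gcongr
  · exact ae_of_all _ fun z hz => absurd hz.1 ha

theorem sliceBound_nonneg (h₀ : 0 ≤ G₀) (hM₀ : 0 ≤ M) (a : ℝ) : 0 ≤ sliceBound G₀ M w a := by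
  have h1 := indicator_sq_integral_nonneg (domain H) w.val a
  have h2 := indicator_sq_integral_nonneg (domain H) w.d₂ a
  rw [sliceBound]
  positivity

include hH in
theorem integrable_sliceBound : Integrable (sliceBound G₀ M w) :=
  ((integrable_integral_slice hH.measurableSet w.memLp_val.integrable_sq).const_mul _).add
    ((integrable_integral_slice hH.measurableSet w.memLp_d₂.integrable_sq).const_mul _)

include hH in
theorem integral_sliceBound : ∫ a, sliceBound G₀ M w a
    = 2 / G₀ * (∫ x in domain H, w.val x ^ 2) + 2 * M * ∫ x in domain H, w.d₂ x ^ 2 := by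
  simp only [sliceBound]
  rw [integral_add
    ((integrable_integral_slice hH.measurableSet w.memLp_val.integrable_sq).const_mul _)
    ((integrable_integral_slice hH.measurableSet w.memLp_d₂.integrable_sq).const_mul _),
    integral_const_mul, integral_const_mul,
    integral_integral_slice hH.measurableSet w.memLp_val.integrable_sq,
    integral_integral_slice hH.measurableSet w.memLp_d₂.integrable_sq]

end Slices

/-- A function on a set of height at most `d` that is bounded on vertical lines by `K x₁` has integral
at most `d ∫ K`. -/
theorem setIntegral_le_of_ae_slice_le {A : Set (ℝ × ℝ)} {F : ℝ × ℝ → ℝ} {K : ℝ → ℝ} {d : ℝ}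
    (hA : MeasurableSet A) (hF : IntegrableOn F A) (hK : Integrable K) (hK0 : ∀ a, 0 ≤ K a)
    (hd : 0 ≤ d) (hvol : ∀ a, volume {z | (a, z) ∈ A} ≤ ENNReal.ofReal d)
    (hle : ∀ᵐ a, ∀ᵐ z, (a, z) ∈ A → F (a, z) ≤ K a) :
    ∫ x in A, F x ≤ d * ∫ a, K a := by
  rw [← integral_integral_slice hA hF, ← integral_const_mul]
  refine integral_mono_ae (integrable_integral_slice hA hF) (hK.const_mul d) ?_
  filter_upwards [hle, ((integrable_indicator_iff hA).2 hF).prod_right_ae] with a ha hi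
  have hs : MeasurableSet {z | (a, z) ∈ A} := measurable_prodMk_left hA
  have hfin : volume {z | (a, z) ∈ A} ≠ ⊤ := ((hvol a).trans_lt ENNReal.ofReal_lt_top).ne
  calc ∫ z, A.indicator F (a, z) ≤ ∫ z, {z | (a, z) ∈ A}.indicator (fun _ => K a) z := by
        refine integral_mono_ae hi
          ((integrable_indicator_iff hs).2 (integrableOn_const hfin)) ?_
        filter_upwards [ha] with z hz
        by_cases hzA : (a, z) ∈ A
        · rw [indicator_of_mem hzA, indicator_of_mem (show z ∈ {z | (a, z) ∈ A} from hzA)]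
          exact hz hzA
        · rw [indicator_of_notMem hzA, indicator_of_notMem (show z ∉ {z | (a, z) ∈ A} from hzA)]
    _ = volume.real {z | (a, z) ∈ A} * K a := by
        rw [integral_indicator hs, setIntegral_const, smul_eq_mul]
    _ ≤ d * K a := mul_le_mul_of_nonneg_right
        (ENNReal.toReal_le_of_le_ofReal hd (hvol a)) (hK0 a)

theorem volume_slice_diff_le {G H : ℝ → ℝ} {d : ℝ} (hGH : ∀ x ∈ Ioo (0 : ℝ) 1, G x ≤ H x + d)
    (a : ℝ) : volume {z | (a, z) ∈ domain G \ domain H} ≤ ENNReal.ofReal d := by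
  have hsub : {z | (a, z) ∈ domain G \ domain H} ⊆ Ico (H a) (H a + d) := by
    rintro z ⟨⟨ha, hz, hzG⟩, hn⟩
    refine ⟨not_lt.1 fun h => hn ⟨ha, hz, h⟩, hzG.trans_le (hGH a ha)⟩
  refine (measure_mono hsub).trans ?_
  rw [Real.volume_Ico, add_sub_cancel_left]

theorem volume_slice_domain_le {H : ℝ → ℝ} {M : ℝ} (hM : ∀ x ∈ Ioo (0 : ℝ) 1, H x ≤ M)
    (a : ℝ) : volume {z | (a, z) ∈ domain H} ≤ ENNReal.ofReal M := by
  have hsub : {z | (a, z) ∈ domain H} ⊆ Ioo 0 M :=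
    fun z hz => ⟨hz.2.1, hz.2.2.trans_le (hM a hz.1)⟩
  refine (measure_mono hsub).trans ?_
  rw [Real.volume_Ioo, sub_zero]

/-! ### Comparison of energies -/

theorem normSq_nonneg (ε : ℝ) (A : Set (ℝ × ℝ)) (w w₁ w₂ : ℝ × ℝ → ℝ) :
    0 ≤ normSq ε A w w₁ w₂ := by
  have h : ∀ k : ℝ × ℝ → ℝ, 0 ≤ ∫ x in A, k x ^ 2 := fun k => integral_nonneg fun x => sq_nonneg _
  have h1 := h w
  have h2 := h w₁
  have h3 := h w₂
  rw [normSq]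
  positivity

theorem integral_sq_val_le_normSq (ε : ℝ) (A : Set (ℝ × ℝ)) (w w₁ w₂ : ℝ × ℝ → ℝ) :
    ∫ x in A, w x ^ 2 ≤ normSq ε A w w₁ w₂ := by
  have h2 : 0 ≤ ∫ x in A, w₁ x ^ 2 := integral_nonneg fun x => sq_nonneg _
  have h3 : 0 ≤ 1 / ε ^ 2 * ∫ x in A, w₂ x ^ 2 :=
    mul_nonneg (by positivity) (integral_nonneg fun x => sq_nonneg _)
  rw [normSq]
  linarith

theorem integral_sq_d₂_le_normSq {ε : ℝ} (hε : 0 < ε) (A : Set (ℝ × ℝ)) (w w₁ w₂ : ℝ × ℝ → ℝ) :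
    ∫ x in A, w₂ x ^ 2 ≤ ε ^ 2 * normSq ε A w w₁ w₂ := by
  have h1 : 0 ≤ ∫ x in A, w x ^ 2 := integral_nonneg fun x => sq_nonneg _
  have h2 : 0 ≤ ∫ x in A, w₁ x ^ 2 := integral_nonneg fun x => sq_nonneg _
  have e : ∫ x in A, w₂ x ^ 2 = ε ^ 2 * (1 / ε ^ 2 * ∫ x in A, w₂ x ^ 2) := by field_simp
  rw [e]
  refine mul_le_mul_of_nonneg_left ?_ (sq_nonneg ε)
  rw [normSq]
  linarith

theorem H1.normSq_add_normSq_diff {U V : Set (ℝ × ℝ)} (w : H1 U) (ε : ℝ) (hV : MeasurableSet V)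
    (hVU : V ⊆ U) :
    normSq ε V w.val w.d₁ w.d₂ + normSq ε (U \ V) w.val w.d₁ w.d₂ = normSq ε U w.val w.d₁ w.d₂ := by
  have h : ∀ k : ℝ × ℝ → ℝ, MemLp k 2 (volume.restrict U) →
      (∫ x in V, k x ^ 2) + ∫ x in U \ V, k x ^ 2 = ∫ x in U, k x ^ 2 := by
    intro k hk
    have := integral_inter_add_sdiff hV (show IntegrableOn (fun x => k x ^ 2) U volume from hk.integrable_sq)
    rwa [inter_eq_self_of_subset_right hVU] at this
  simp only [normSq]
  rw [← h _ w.memLp_val, ← h _ w.memLp_d₁, ← h _ w.memLp_d₂]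
  ring

/-- The bilinear form of the variational problem. -/
noncomputable def energyForm (ε : ℝ) {U : Set (ℝ × ℝ)} (u φ : H1 U) : ℝ :=
  ∫ x in U, (u.d₁ x * φ.d₁ x + 1 / ε ^ 2 * (u.d₂ x * φ.d₂ x) + u.val x * φ.val x)

theorem energyForm_eq (ε : ℝ) {U : Set (ℝ × ℝ)} (u φ : H1 U) :
    energyForm ε u φ = (∫ x in U, u.d₁ x * φ.d₁ x) + 1 / ε ^ 2 * (∫ x in U, u.d₂ x * φ.d₂ x)
      + ∫ x in U, u.val x * φ.val x := by
  have i1 : Integrable (fun x => u.d₁ x * φ.d₁ x) (volume.restrict U) :=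
    u.memLp_d₁.integrable_mul (q := 2) φ.memLp_d₁
  have i2 : Integrable (fun x => 1 / ε ^ 2 * (u.d₂ x * φ.d₂ x)) (volume.restrict U) :=
    (u.memLp_d₂.integrable_mul (q := 2) φ.memLp_d₂).const_mul (1 / ε ^ 2)
  have i3 : Integrable (fun x => u.val x * φ.val x) (volume.restrict U) :=
    u.memLp_val.integrable_mul (q := 2) φ.memLp_val
  have i12 : Integrable (fun x => u.d₁ x * φ.d₁ x + 1 / ε ^ 2 * (u.d₂ x * φ.d₂ x))
    (volume.restrict U) := i1.add i2
  rw [energyForm, integral_add i12 i3, integral_add i1 i2, integral_const_mul]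

theorem energyForm_self (ε : ℝ) {U : Set (ℝ × ℝ)} (u : H1 U) :
    energyForm ε u u = normSq ε U u.val u.d₁ u.d₂ := by
  rw [energyForm_eq, normSq]
  simp only [pow_two]
  ring

theorem integral_mul_le_half_add {U : Set (ℝ × ℝ)} {k k' : ℝ × ℝ → ℝ}
    (h : MemLp k 2 (volume.restrict U)) (h' : MemLp k' 2 (volume.restrict U)) :
    ∫ x in U, k x * k' x ≤ 1 / 2 * (∫ x in U, k x ^ 2) + 1 / 2 * ∫ x in U, k' x ^ 2 := by
  rw [← integral_const_mul, ← integral_const_mul,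
    ← integral_add (h.integrable_sq.const_mul _) (h'.integrable_sq.const_mul _)]
  refine integral_mono (h.integrable_mul (q := 2) h')
    ((h.integrable_sq.const_mul _).add (h'.integrable_sq.const_mul _)) fun x => ?_
  simp only
  nlinarith [sq_nonneg (k x - k' x)]

theorem energyForm_le (ε : ℝ) {U : Set (ℝ × ℝ)} (u φ : H1 U) :
    energyForm ε u φ ≤ 1 / 2 * normSq ε U u.val u.d₁ u.d₂
      + 1 / 2 * normSq ε U φ.val φ.d₁ φ.d₂ := by
  have h1 := integral_mul_le_half_add u.memLp_d₁ φ.memLp_d₁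
  have h2 := mul_le_mul_of_nonneg_left (integral_mul_le_half_add u.memLp_d₂ φ.memLp_d₂)
    (show 0 ≤ 1 / ε ^ 2 by positivity)
  have h3 := integral_mul_le_half_add u.memLp_val φ.memLp_val
  rw [energyForm_eq, normSq, normSq]
  linarith

/-- A solution minimizes the energy. -/
theorem IsSolution.energy_le {ε : ℝ} {U : Set (ℝ × ℝ)} {f : ℝ × ℝ → ℝ} {u : H1 U}
    (hu : IsSolution ε f u) (ψ : H1 U) :
    1 / 2 * normSq ε U u.val u.d₁ u.d₂ - ∫ x in U, f x * u.val x
      ≤ 1 / 2 * normSq ε U ψ.val ψ.d₁ ψ.d₂ - ∫ x in U, f x * ψ.val x := by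
  have h1 : energyForm ε u u = _ := hu u
  have h2 : energyForm ε u ψ = _ := hu ψ
  have h3 := energyForm_le ε u ψ
  rw [energyForm_self] at h1
  linarith

/-- The a priori bound, from testing the equation with the solution itself. -/
theorem IsSolution.normSq_le_one {ε : ℝ} {U : Set (ℝ × ℝ)} {f : ℝ × ℝ → ℝ} {u : H1 U}
    (hu : IsSolution ε f u) (hf : MemLp f 2 volume) (hf1 : ∫ x, f x ^ 2 ≤ 1) :
    normSq ε U u.val u.d₁ u.d₂ ≤ 1 := by
  have h1 : energyForm ε u u = _ := hu u
  have h2 := integral_mul_le_half_add (hf.restrict U) u.memLp_val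
  have h3 := integral_sq_val_le_normSq ε U u.val u.d₁ u.d₂
  have h4 := setIntegral_le_integral (s := U) hf.integrable_sq (ae_of_all _ fun x => sq_nonneg (f x))
  rw [energyForm_self] at h1
  linarith

theorem abs_setIntegral_mul_le_sqrt {A : Set (ℝ × ℝ)} {f k : ℝ × ℝ → ℝ} {B : ℝ}
    (hf : MemLp f 2 volume) (hf1 : ∫ x, f x ^ 2 ≤ 1) (hk : MemLp k 2 (volume.restrict A))
    (hB : ∫ x in A, k x ^ 2 ≤ B) : |∫ x in A, f x * k x| ≤ √B := by
  refine Real.abs_le_sqrt ?_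
  have h := sq_integral_mul_le (hf.restrict A).integrable_sq hk.integrable_sq
    ((hf.restrict A).integrable_mul (q := 2) hk)
  have h4 := setIntegral_le_integral (s := A) hf.integrable_sq (ae_of_all _ fun x => sq_nonneg (f x))
  have h5 : 0 ≤ ∫ x in A, k x ^ 2 := integral_nonneg fun x => sq_nonneg _
  refine h.trans ((mul_le_of_le_one_left h5 (h4.trans hf1)).trans hB)

theorem integral_sq_le_one_of_eLpNorm_le {f : ℝ × ℝ → ℝ} (hf : MemLp f 2 volume)
    (hf1 : eLpNorm f 2 volume ≤ 1) : ∫ x, f x ^ 2 ≤ 1 := by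
  have h := hf.eLpNorm_eq_integral_rpow_norm two_ne_zero ENNReal.ofNat_ne_top
  rw [h, ENNReal.ofReal_le_one] at hf1
  have h0 : 0 ≤ ∫ x, f x ^ 2 := integral_nonneg fun x => sq_nonneg _
  simp only [ENNReal.toReal_ofNat, Real.norm_eq_abs, Real.rpow_two, sq_abs] at hf1
  by_contra hlt
  exact absurd hf1 (not_le.2 (Real.one_lt_rpow (not_le.1 hlt) (by norm_num)))

theorem normSq_dilate_le {U V : Set (ℝ × ℝ)} (w : H1 U) {l : ℝ} (hl : 0 < l) (hl1 : 1 ≤ l)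
    (hU : MeasurableSet U) (hVU : ∀ x ∈ V, (x.1, x.2 / l) ∈ U) (ε : ℝ) :
    normSq ε V (w.dilate hl hU hVU).val (w.dilate hl hU hVU).d₁ (w.dilate hl hU hVU).d₂
      ≤ l * normSq ε U w.val w.d₁ w.d₂ := by
  have h1 := setIntegral_comp_shrink_le hl hU hVU w.memLp_val
  have h2 := setIntegral_comp_shrink_le hl hU hVU w.memLp_d₁
  have h3 := setIntegral_comp_shrink_le hl hU hVU w.memLp_d₂
  have h4 : l⁻¹ ^ 2 * ∫ x in V, w.d₂ (x.1, x.2 / l) ^ 2 ≤ l * ∫ x in U, w.d₂ x ^ 2 :=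
    (mul_le_of_le_one_left (integral_nonneg fun x => sq_nonneg _)
      (pow_le_one₀ (by positivity) (inv_le_one_of_one_le₀ hl1))).trans h3
  have h5 := mul_le_mul_of_nonneg_left h4 (show 0 ≤ 1 / ε ^ 2 by positivity)
  simp only [normSq, H1.dilate, inv_one, one_mul, mul_pow, integral_const_mul] at h5 ⊢
  linarith

/-- The error in comparing the energies on two domains whose profiles differ by at most `δ`: the
gain of norm under the dilation by `1 + δ / G₀`, the `L²` distance of a function from its dilation,
and two `L²` norms over a strip of height `δ`. It is of order `√δ` as `δ → 0`. -/
noncomputable def energyError (G₀ M ε₀ δ : ℝ) : ℝ :=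
  1 / 2 * (δ / G₀) + √(M * (M * (δ / G₀) * ε₀ ^ 2)) + 2 * √(δ * (2 / G₀ + 2 * M * ε₀ ^ 2))

/-- Comparison of the energy of a solution with that of any competitor `φ` on a smaller domain:
the dilation of `φ` is admissible for the solution, and dilating changes the energy little. The
energy of the solution on the difference of the domains comes for free. -/
theorem IsSolution.energy_le_of_subdomain {G H : ℝ → ℝ} {G₀ M ε ε₀ δ : ℝ} {f : ℝ × ℝ → ℝ}
    (hG : IsOpen (domain G)) (hH : IsOpen (domain H)) (hG₀ : 0 < G₀) (hM₀ : 0 ≤ M) (hδ : 0 ≤ δ)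
    (hε : 0 < ε) (hεε : ε ≤ ε₀)
    (hlow : ∀ x ∈ Ioo (0 : ℝ) 1, G₀ ≤ H x) (hHG : ∀ x ∈ Ioo (0 : ℝ) 1, H x ≤ G x)
    (hM : ∀ x ∈ Ioo (0 : ℝ) 1, G x ≤ M) (hGH : ∀ x ∈ Ioo (0 : ℝ) 1, G x ≤ H x + δ)
    (hf : MemLp f 2 volume) (hf1 : ∫ x, f x ^ 2 ≤ 1)
    {u : H1 (domain G)} (hu : IsSolution ε f u)
    (φ : H1 (domain H)) (hφ : normSq ε (domain H) φ.val φ.d₁ φ.d₂ ≤ 1) :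
    1 / 2 * normSq ε (domain H) u.val u.d₁ u.d₂
        + 1 / 2 * normSq ε (domain G \ domain H) u.val u.d₁ u.d₂ - ∫ x in domain H, f x * u.val x
      ≤ 1 / 2 * normSq ε (domain H) φ.val φ.d₁ φ.d₂ - (∫ x in domain H, f x * φ.val x)
        + energyError G₀ M ε₀ δ := by
  have hUm := hG.measurableSet
  have hDm := hH.measurableSet
  have hDU : domain H ⊆ domain G := fun x hx => ⟨hx.1, hx.2.1, hx.2.2.trans_le (hHG _ hx.1)⟩
  have hSm : MeasurableSet (domain G \ domain H) := hUm.diff hDm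
  have hMH : ∀ x ∈ Ioo (0 : ℝ) 1, H x ≤ M := fun x hx => (hHG x hx).trans (hM x hx)
  have hlowG : ∀ x ∈ Ioo (0 : ℝ) 1, G₀ ≤ G x := fun x hx => (hlow x hx).trans (hHG x hx)
  set η := δ / G₀ with hη
  have hη0 : 0 ≤ η := by positivity
  set l := 1 + η with hl
  have hl1 : 1 ≤ l := by linarith
  have hl0 : 0 < l := by linarith
  -- `G ≤ H + δ ≤ l H`, as `δ = (l - 1) G₀` and `G₀ ≤ H`
  have hVU : ∀ x ∈ domain G, (x.1, x.2 / l) ∈ domain H := by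
    rintro ⟨a, z⟩ ⟨ha, hz, hzG⟩
    refine ⟨ha, div_pos hz hl0, ?_⟩
    simp only at ha hz hzG ⊢
    rw [div_lt_iff₀ hl0]
    have h1 : δ = η * G₀ := by rw [hη]; field_simp
    have h2 : η * G₀ ≤ η * H a := mul_le_mul_of_nonneg_left (hlow a ha) hη0
    have h3 := hGH a ha
    rw [hl]
    linarith
  set ψ : H1 (domain G) := φ.dilate hl0 hDm hVU
  have hNu := hu.normSq_le_one hf hf1
  have hNψ : normSq ε (domain G) ψ.val ψ.d₁ ψ.d₂
      ≤ normSq ε (domain H) φ.val φ.d₁ φ.d₂ + η := by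
    have h1 : normSq ε (domain G) ψ.val ψ.d₁ ψ.d₂
        ≤ (1 + η) * normSq ε (domain H) φ.val φ.d₁ φ.d₂ := normSq_dilate_le φ hl0 hl1 hDm hVU ε
    have h2 : η * normSq ε (domain H) φ.val φ.d₁ φ.d₂ ≤ η := mul_le_of_le_one_right hη0 hφ
    linarith
  have hsq : ε ^ 2 ≤ ε₀ ^ 2 := by gcongr
  -- bounds by the energy for the integrals of the majorants over the vertical lines
  have hK : ∀ {J : ℝ → ℝ} (hJ : IsOpen (domain J)) (w : H1 (domain J)),
      normSq ε (domain J) w.val w.d₁ w.d₂ ≤ 1 →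
      ∫ a, sliceBound G₀ M w a ≤ 2 / G₀ + 2 * M * ε₀ ^ 2 := by
    intro J hJ w hw
    rw [integral_sliceBound hJ]
    have h1 := (integral_sq_val_le_normSq ε (domain J) w.val w.d₁ w.d₂).trans hw
    have h2 : ∫ x in domain J, w.d₂ x ^ 2 ≤ ε₀ ^ 2 :=
      (integral_sq_d₂_le_normSq hε (domain J) w.val w.d₁ w.d₂).trans
        ((mul_le_of_le_one_right (sq_nonneg ε) hw).trans hsq)
    have h3 : 2 / G₀ * (∫ x in domain J, w.val x ^ 2) ≤ 2 / G₀ :=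
      mul_le_of_le_one_right (by positivity) h1
    have h4 := mul_le_mul_of_nonneg_left h2 (show 0 ≤ 2 * M by positivity)
    linarith
  -- the solution and the dilated competitor are small on the difference of the domains
  have hSu : ∫ x in domain G \ domain H, u.val x ^ 2 ≤ δ * (2 / G₀ + 2 * M * ε₀ ^ 2) := by
    refine (setIntegral_le_of_ae_slice_le hSm
      (IntegrableOn.mono_set u.memLp_val.integrable_sq sdiff_subset)
      (integrable_sliceBound hG u (G₀ := G₀) (M := M)) (sliceBound_nonneg u hG₀.le hM₀) hδ
      (volume_slice_diff_le hGH) ?_).trans (mul_le_mul_of_nonneg_left (hK hG u hNu) hδ)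
    filter_upwards [H1.ae_sq_le_sliceBound hG hG₀ hlowG hM u] with a ha
    filter_upwards [ha] with z hz hzS
    exact hz hzS.1
  have hSψ : ∫ x in domain G \ domain H, ψ.val x ^ 2 ≤ δ * (2 / G₀ + 2 * M * ε₀ ^ 2) := by
    refine (setIntegral_le_of_ae_slice_le hSm
      (IntegrableOn.mono_set ψ.memLp_val.integrable_sq sdiff_subset)
      (integrable_sliceBound hH φ (G₀ := G₀) (M := M)) (sliceBound_nonneg φ hG₀.le hM₀) hδ
      (volume_slice_diff_le hGH) ?_).trans (mul_le_mul_of_nonneg_left (hK hH φ hφ) hδ)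
    filter_upwards [H1.ae_sq_le_sliceBound hH hG₀ hlow hMH φ] with a ha
    filter_upwards [(quasiMeasurePreserving_div_const hl0.ne').ae ha] with z hz hzS
    exact hz (hVU _ hzS.1)
  have hDi := integrable_integral_slice hDm (show IntegrableOn (fun x => φ.d₂ x ^ 2)
    (domain H) volume from φ.memLp_d₂.integrable_sq)
  have hψD : MemLp (fun x => ψ.val x - φ.val x) 2 (volume.restrict (domain H)) :=
    (ψ.restrict hDU).memLp_val.sub φ.memLp_val
  have hDψ : ∫ x in domain H, (ψ.val x - φ.val x) ^ 2 ≤ M * (M * η * ε₀ ^ 2) := by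
    refine (setIntegral_le_of_ae_slice_le (K := fun a => M * (l - 1) *
      ∫ z, (domain H).indicator (fun x => φ.d₂ x ^ 2) (a, z)) hDm hψD.integrable_sq
      (hDi.const_mul _) (fun a => mul_nonneg (mul_nonneg hM₀ (by linarith))
        (indicator_sq_integral_nonneg _ _ a)) hM₀ (volume_slice_domain_le hMH) ?_).trans
      (mul_le_mul_of_nonneg_left ?_ hM₀)
    · exact H1.ae_sq_dilate_sub_le hH hMH φ hl1
    · rw [integral_const_mul, integral_integral_slice hDm φ.memLp_d₂.integrable_sq, hl,
        add_sub_cancel_left]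
      refine mul_le_mul_of_nonneg_left ?_ (mul_nonneg hM₀ hη0)
      exact (integral_sq_d₂_le_normSq hε (domain H) φ.val φ.d₁ φ.d₂).trans
        ((mul_le_of_le_one_right (sq_nonneg ε) hφ).trans hsq)
  have hfU : ∀ w : H1 (domain G), IntegrableOn (fun x => f x * w.val x) (domain G) :=
    fun w => (hf.restrict _).integrable_mul (q := 2) w.memLp_val
  have hsplit : ∀ w : H1 (domain G), (∫ x in domain H, f x * w.val x)
      + ∫ x in domain G \ domain H, f x * w.val x = ∫ x in domain G, f x * w.val x := by
    intro w
    have := integral_inter_add_sdiff hDm (hfU w)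
    rwa [inter_eq_self_of_subset_right hDU] at this
  have hDfψ : ∫ x in domain H, f x * ψ.val x
      = (∫ x in domain H, f x * φ.val x) + ∫ x in domain H, f x * (ψ.val x - φ.val x) := by
    have h := integral_add ((hf.restrict _).integrable_mul (q := 2) φ.memLp_val)
      ((hf.restrict _).integrable_mul (q := 2) hψD)
    simp only [Pi.mul_apply] at h
    rw [← h]
    exact integral_congr_ae (ae_of_all _ fun x => by ring)
  have hmemS : ∀ w : H1 (domain G), MemLp w.val 2 (volume.restrict (domain G \ domain H)) :=
    fun w => (w.restrict sdiff_subset).memLp_val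
  have e1 := abs_le.1 (abs_setIntegral_mul_le_sqrt hf hf1 (hmemS u) hSu)
  have e2 := abs_le.1 (abs_setIntegral_mul_le_sqrt hf hf1 (hmemS ψ) hSψ)
  have e3 := abs_le.1 (abs_setIntegral_mul_le_sqrt hf hf1 hψD hDψ)
  have henergy := hu.energy_le ψ
  rw [← hsplit u, ← hsplit ψ, hDfψ, ← u.normSq_add_normSq_diff ε hDm hDU] at henergy
  rw [energyError]
  linarith [e1.1, e1.2, e2.1, e2.2, e3.1, e3.2]

/-! ### Uniform convexity and the distance of the solutions -/

theorem setIntegral_sq_sub_add {U : Set (ℝ × ℝ)} {k k' : ℝ × ℝ → ℝ}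
    (h : MemLp k 2 (volume.restrict U)) (h' : MemLp k' 2 (volume.restrict U)) :
    (∫ x in U, (k x - k' x) ^ 2) + 4 * ∫ x in U, (1 / 2 * (k x + k' x)) ^ 2
      = 2 * (∫ x in U, k x ^ 2) + 2 * ∫ x in U, k' x ^ 2 := by
  have i1 : Integrable (fun x => (k x - k' x) ^ 2) (volume.restrict U) := (h.sub h').integrable_sq
  have i2 : Integrable (fun x => (1 / 2 * (k x + k' x)) ^ 2) (volume.restrict U) :=
    ((h.add h').const_mul (1 / 2)).integrable_sq
  rw [← integral_const_mul, ← integral_const_mul, ← integral_const_mul,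
    ← integral_add i1 (i2.const_mul 4),
    ← integral_add (h.integrable_sq.const_mul 2) (h'.integrable_sq.const_mul 2)]
  exact integral_congr_ae (ae_of_all _ fun x => by ring)

/-- The parallelogram identity for the `H¹_ε` norm. -/
theorem normSq_sub_add_normSq_midpoint {U : Set (ℝ × ℝ)} (ε : ℝ) (u w : H1 U) :
    normSq ε U (fun x => u.val x - w.val x) (fun x => u.d₁ x - w.d₁ x) (fun x => u.d₂ x - w.d₂ x)
        + 4 * normSq ε U (u.midpoint w).val (u.midpoint w).d₁ (u.midpoint w).d₂
      = 2 * normSq ε U u.val u.d₁ u.d₂ + 2 * normSq ε U w.val w.d₁ w.d₂ := by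
  have h1 := setIntegral_sq_sub_add u.memLp_val w.memLp_val
  have h2 := setIntegral_sq_sub_add u.memLp_d₁ w.memLp_d₁
  have h3 := setIntegral_sq_sub_add u.memLp_d₂ w.memLp_d₂
  simp only [normSq, H1.midpoint]
  linear_combination h1 + h2 + 1 / ε ^ 2 * h3

theorem integral_mul_midpoint {U : Set (ℝ × ℝ)} {f : ℝ × ℝ → ℝ} (hf : MemLp f 2 volume)
    (u w : H1 U) : ∫ x in U, f x * (u.midpoint w).val x
      = 1 / 2 * ((∫ x in U, f x * u.val x) + ∫ x in U, f x * w.val x) := by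
  have i1 : Integrable (fun x => f x * u.val x) (volume.restrict U) :=
    (hf.restrict _).integrable_mul (q := 2) u.memLp_val
  have i2 : Integrable (fun x => f x * w.val x) (volume.restrict U) :=
    (hf.restrict _).integrable_mul (q := 2) w.memLp_val
  rw [← integral_add i1 i2, ← integral_const_mul]
  exact integral_congr_ae (ae_of_all _ fun x => by simp only [H1.midpoint]; ring)

/-- The quantity to be estimated: the distance of the solutions on the intersection of the two
domains, and their sizes on the two differences. -/
noncomputable def discrepancy (ε : ℝ) {U V : Set (ℝ × ℝ)} (u : H1 U) (w : H1 V) : ℝ :=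
  normSq ε (U ∩ V) (fun x => u.val x - w.val x) (fun x => u.d₁ x - w.d₁ x)
      (fun x => u.d₂ x - w.d₂ x)
    + normSq ε (U \ V) u.val u.d₁ u.d₂ + normSq ε (V \ U) w.val w.d₁ w.d₂

theorem discrepancy_le_four {ε : ℝ} {U V : Set (ℝ × ℝ)} (hU : MeasurableSet U)
    (hV : MeasurableSet V) {f : ℝ × ℝ → ℝ} (hf : MemLp f 2 volume) (hf1 : ∫ x, f x ^ 2 ≤ 1)
    {u : H1 U} {w : H1 V} (hu : IsSolution ε f u) (hw : IsSolution ε f w) :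
    discrepancy ε u w ≤ 4 := by
  have hDU : U ∩ V ⊆ U := inter_subset_left
  have hDV : U ∩ V ⊆ V := inter_subset_right
  have h1 : normSq ε (U ∩ V) (fun x => u.val x - w.val x) (fun x => u.d₁ x - w.d₁ x)
      (fun x => u.d₂ x - w.d₂ x) + 4 * _
      = 2 * normSq ε (U ∩ V) u.val u.d₁ u.d₂ + 2 * normSq ε (U ∩ V) w.val w.d₁ w.d₂ :=
    normSq_sub_add_normSq_midpoint ε (u.restrict hDU) (w.restrict hDV)
  have h2 := normSq_nonneg ε (U ∩ V) ((u.restrict hDU).midpoint (w.restrict hDV)).val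
    ((u.restrict hDU).midpoint (w.restrict hDV)).d₁ ((u.restrict hDU).midpoint (w.restrict hDV)).d₂
  have h3 := u.normSq_add_normSq_diff ε (hU.inter hV) hDU
  have h4 := w.normSq_add_normSq_diff ε (hU.inter hV) hDV
  rw [sdiff_inter_self_eq_sdiff] at h4
  rw [sdiff_self_inter] at h3
  have h5 := hu.normSq_le_one hf hf1
  have h6 := hw.normSq_le_one hf hf1
  have h7 := normSq_nonneg ε (U \ V) u.val u.d₁ u.d₂
  have h8 := normSq_nonneg ε (V \ U) w.val w.d₁ w.d₂
  rw [discrepancy]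
  linarith

/-- Both solutions nearly minimize the energy on the intersection of their domains; comparison with
their midpoint there shows, by uniform convexity, that they are close. -/
theorem discrepancy_le_energyError {G G' : ℝ → ℝ} {G₀ M ε ε₀ δ : ℝ} {f : ℝ × ℝ → ℝ}
    (hG : IsOpen (domain G)) (hG' : IsOpen (domain G')) (hG₀ : 0 < G₀) (hδ : 0 ≤ δ)
    (hε : 0 < ε) (hεε : ε ≤ ε₀) (hM₀ : 0 ≤ M)
    (hGb : ∀ x ∈ Ioo (0 : ℝ) 1, G₀ ≤ G x ∧ G x ≤ M)
    (hGb' : ∀ x ∈ Ioo (0 : ℝ) 1, G₀ ≤ G' x ∧ G' x ≤ M)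
    (hGG : ∀ x ∈ Ioo (0 : ℝ) 1, |G x - G' x| ≤ δ)
    (hf : MemLp f 2 volume) (hf1 : ∫ x, f x ^ 2 ≤ 1)
    {u : H1 (domain G)} {w : H1 (domain G')} (hu : IsSolution ε f u) (hw : IsSolution ε f w) :
    discrepancy ε u w ≤ 8 * energyError G₀ M ε₀ δ := by
  set H : ℝ → ℝ := fun x => min (G x) (G' x) with hHdef
  have hD : domain G ∩ domain G' = domain H := domain_inter_domain G G'
  have hH : IsOpen (domain H) := hD ▸ hG.inter hG'
  have hDU : domain H ⊆ domain G := hD ▸ inter_subset_left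
  have hDV : domain H ⊆ domain G' := hD ▸ inter_subset_right
  have hS : domain G \ domain G' = domain G \ domain H := by rw [← hD, sdiff_self_inter]
  have hS' : domain G' \ domain G = domain G' \ domain H := by
    rw [← hD, sdiff_inter_self_eq_sdiff]
  set φ : H1 (domain H) := (u.restrict hDU).midpoint (w.restrict hDV) with hφ
  have hpar : normSq ε (domain H) (fun x => u.val x - w.val x) (fun x => u.d₁ x - w.d₁ x)
      (fun x => u.d₂ x - w.d₂ x) + 4 * normSq ε (domain H) φ.val φ.d₁ φ.d₂
      = 2 * normSq ε (domain H) u.val u.d₁ u.d₂ + 2 * normSq ε (domain H) w.val w.d₁ w.d₂ :=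
    normSq_sub_add_normSq_midpoint ε (u.restrict hDU) (w.restrict hDV)
  have hmid : ∫ x in domain H, f x * φ.val x = 1 / 2 * ((∫ x in domain H, f x * u.val x)
      + ∫ x in domain H, f x * w.val x) :=
    integral_mul_midpoint hf (u.restrict hDU) (w.restrict hDV)
  have hnu := hu.normSq_le_one hf hf1
  have hnw := hw.normSq_le_one hf hf1
  have hdu := u.normSq_add_normSq_diff ε hH.measurableSet hDU
  have hdw := w.normSq_add_normSq_diff ε hH.measurableSet hDV
  have hsu := normSq_nonneg ε (domain G \ domain H) u.val u.d₁ u.d₂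
  have hsw := normSq_nonneg ε (domain G' \ domain H) w.val w.d₁ w.d₂
  have hdiff := normSq_nonneg ε (domain H) (fun x => u.val x - w.val x)
    (fun x => u.d₁ x - w.d₁ x) (fun x => u.d₂ x - w.d₂ x)
  have hφ1 : normSq ε (domain H) φ.val φ.d₁ φ.d₂ ≤ 1 := by linarith
  have hlow : ∀ x ∈ Ioo (0 : ℝ) 1, G₀ ≤ H x := fun x hx => le_min (hGb x hx).1 (hGb' x hx).1
  have key := hu.energy_le_of_subdomain hG hH hG₀ hM₀ hδ hε hεε hlow
    (fun x _ => min_le_left _ _) (fun x hx => (hGb x hx).2)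
    (fun x hx => by
      have := abs_le.1 (hGG x hx)
      rw [hHdef, ← sub_le_iff_le_add]
      exact le_min (by linarith) (by linarith [this.2])) hf hf1 φ hφ1
  have key' := hw.energy_le_of_subdomain hG' hH hG₀ hM₀ hδ hε hεε hlow
    (fun x _ => min_le_right _ _) (fun x hx => (hGb' x hx).2)
    (fun x hx => by
      have := abs_le.1 (hGG x hx)
      rw [hHdef, ← sub_le_iff_le_add]
      exact le_min (by linarith [this.1]) (by linarith)) hf hf1 φ hφ1
  rw [discrepancy, hD, hS, hS']
  linarith

theorem energyError_le_mul_sqrt {G₀ M ε₀ δ : ℝ} (hG₀ : 0 < G₀) (hM₀ : 0 ≤ M)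
    (hε₀ : 0 < ε₀) (hδ : 0 ≤ δ) (hδ1 : δ ≤ 1) :
    energyError G₀ M ε₀ δ ≤ energyError G₀ M ε₀ 1 * √δ := by
  have h1 : δ ≤ √δ := Real.le_sqrt_of_sq_le (by nlinarith)
  have e1 : √(M * (M * (δ / G₀) * ε₀ ^ 2)) = √(M * (M * (1 / G₀) * ε₀ ^ 2)) * √δ := by
    rw [← Real.sqrt_mul (by positivity)]
    congr 1
    ring
  have e2 : √(δ * (2 / G₀ + 2 * M * ε₀ ^ 2)) = √(1 * (2 / G₀ + 2 * M * ε₀ ^ 2)) * √δ := by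
    rw [← Real.sqrt_mul (by positivity)]
    congr 1
    ring
  have h2 : 1 / 2 * (δ / G₀) ≤ 1 / 2 * (1 / G₀) * √δ := by
    have h3 := div_le_div_of_nonneg_right h1 hG₀.le
    have e3 : 1 / 2 * (1 / G₀) * √δ = 1 / 2 * (√δ / G₀) := by ring
    rw [e3]
    linarith
  rw [energyError, energyError, e1, e2]
  linarith

theorem energyError_nonneg {G₀ M ε₀ δ : ℝ} (hG₀ : 0 < G₀) (hδ : 0 ≤ δ) :
    0 ≤ energyError G₀ M ε₀ δ := by
  rw [energyError]
  positivity

end ThinDomain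

theorem theorem4p1 (G₀ G₁ ε₀ : ℝ) (hG₀ : 0 < G₀) (hG₁ : G₀ ≤ G₁) (hε₀ : 0 < ε₀) :
    ∃ ρ : ℝ≥0 → ℝ≥0,
      Tendsto ρ (𝓝 0) (𝓝 0) ∧
      (∃ C : ℝ≥0, ∀ δ : ℝ≥0, ρ δ ≤ C * δ ^ (1 / 4 : ℝ)) ∧
      ∀ (δ : ℝ≥0) (ε : ℝ), 0 < ε → ε < ε₀ →
      ∀ G Ghat : ℝ → ℝ, ThinDomain.IsProfile G₀ G₁ G → ThinDomain.IsProfile G₀ G₁ Ghat →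
        eLpNorm (fun x => G x - Ghat x) ∞ (volume.restrict (Ioo (0 : ℝ) 1)) ≤ (δ : ℝ≥0∞) →
      ∀ f : ℝ × ℝ → ℝ, MemLp f 2 volume → eLpNorm f 2 volume ≤ 1 →
      ∀ (u : ThinDomain.H1 (ThinDomain.domain G)) (uhat : ThinDomain.H1 (ThinDomain.domain Ghat)),
        ThinDomain.IsSolution ε f u → ThinDomain.IsSolution ε f uhat →
        ThinDomain.normSq ε (ThinDomain.domain G ∩ ThinDomain.domain Ghat)
            (fun x => u.val x - uhat.val x) (fun x => u.d₁ x - uhat.d₁ x)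
            (fun x => u.d₂ x - uhat.d₂ x)
          + ThinDomain.normSq ε (ThinDomain.domain G \ ThinDomain.domain Ghat) u.val u.d₁ u.d₂
          + ThinDomain.normSq ε (ThinDomain.domain Ghat \ ThinDomain.domain G)
              uhat.val uhat.d₁ uhat.d₂
        ≤ (ρ δ : ℝ) := by
  have hM₀ : 0 ≤ G₁ := hG₀.le.trans hG₁
  have hE := ThinDomain.energyError_nonneg (M := G₁) (ε₀ := ε₀) hG₀ zero_le_one
  set E := ThinDomain.energyError G₀ G₁ ε₀ 1
  set C : ℝ≥0 := ⟨4 + 8 * E, by positivity⟩ with hC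
  have hCE : (C : ℝ) = 4 + 8 * E := rfl
  refine ⟨fun δ => C * δ ^ (1 / 4 : ℝ), ?_, ⟨C, fun δ => le_rfl⟩, ?_⟩
  · have h : Tendsto (fun δ : ℝ≥0 => C * δ ^ (1 / 4 : ℝ)) (𝓝 0) (𝓝 (C * 0 ^ (1 / 4 : ℝ))) :=
      ((NNReal.continuous_rpow_const (by norm_num)).tendsto 0).const_mul C
    rwa [NNReal.zero_rpow (by norm_num), mul_zero] at h
  intro δ ε hε hεε G Ghat hG hGhat hδ f hf hf1 u uhat hu huhat
  have hf2 := ThinDomain.integral_sq_le_one_of_eLpNorm_le hf hf1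
  rw [NNReal.coe_mul, NNReal.coe_rpow, hCE]
  change ThinDomain.discrepancy ε u uhat ≤ _
  rcases le_total (δ : ℝ) 1 with h1 | h1
  · have hsqrt : √(δ : ℝ) ≤ (δ : ℝ) ^ (1 / 4 : ℝ) := by
      rcases eq_or_lt_of_le δ.coe_nonneg with h0 | h0
      · rw [← h0, Real.sqrt_zero]
        positivity
      · rw [Real.sqrt_eq_rpow]
        exact Real.rpow_le_rpow_of_exponent_ge h0 h1 (by norm_num)
    have h2 := ThinDomain.discrepancy_le_energyError hG.isOpen_domain hGhat.isOpen_domain hG₀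
      δ.coe_nonneg hε hεε.le hM₀ hG.bounds hGhat.bounds (fun x hx => hG.abs_sub_le hGhat hδ hx)
      hf hf2 hu huhat
    have h3 := ThinDomain.energyError_le_mul_sqrt hG₀ hM₀ hε₀ δ.coe_nonneg h1
    have h4 : E * √(δ : ℝ) ≤ E * (δ : ℝ) ^ (1 / 4 : ℝ) := mul_le_mul_of_nonneg_left hsqrt hE
    have h5 : 0 ≤ (δ : ℝ) ^ (1 / 4 : ℝ) := by positivity
    linarith
  · have h2 := ThinDomain.discrepancy_le_four hG.isOpen_domain.measurableSet
      hGhat.isOpen_domain.measurableSet hf hf2 hu huhat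
    have h3 : 1 ≤ (δ : ℝ) ^ (1 / 4 : ℝ) := Real.one_le_rpow h1 (by norm_num)
    nlinarith
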